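/- For integers $d\ge 2$, $n\ge 0$ let $C_d(n)=\Big[\prod_{p=0}^{d-1}\frac{p!}{(n+p)!}\Big](dn)!$ be the $d$-dimensional Catalan numbers. A weight for $C_d$ is a pair $(R,W)$ where $W$ is a real function that is continuous on $(0,R]$, whose support in $(0,R]$ has upper edge $R$ (that is, $R$ is the least upper bound of the points of $(0,R]$ at which $W\neq 0$), for which $x^nW(x)$ is integrable on $(0,R]$ for every $n\ge 0$, and which solves the Hausdorff moment problem $$\int_0^{R}x^nW(x)\,dx=C_d(n),\qquad n=0,1,2,\ldots$$ Write $(a)_k=a(a+1)\cdots(a+k-1)$ and $${}_pF_q\left({a_1,\ldots,a_p\atop b_1,\ldots,b_q}\Big|z\right)=\sum_{k\ge0}\frac{(a_1)_k\cdots(a_p)_k}{(b_1)_k\cdots(b_q)_k}\frac{z^k}{k!}.$$ For every $d\ge 2$ there is a weight for $C_d$ with $R=d^d$ that is positive on $(0,d^d)$. Every weight $(R,W)$ for $C_d$ has $R=d^d$, and $W=W_d$ on $(0,d^d]$, where for $0<x\le d^d$ $$W_d(x)=\sum_{j=1}^{d-1}\frac{c_j(d)}{x^{j/d}}\;{}_{d-1}F_{d-2}\left({-\frac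 jd,\,-1-\frac jd,\,\ldots,\,-d+2-\frac jd\atop 1-\frac1d,\ldots,1-\frac{j-1}d\,;\;1+\frac1d,\ldots,1+\frac{d-j-1}d}\Big|\frac{x}{d^d}\right),$$ $$c_j(d)=(2\pi)^{\frac{1-d}2}\,d^{\,j-d+\frac12}\left[\prod_{p=1}^{d-1}\frac{p!}{\Gamma(p+\frac jd)}\right]\left[\prod_{k=1}^{j-1}\Gamma\Big(\frac kd\Big)\right]\left[\prod_{k=j+1}^{d-1}\Gamma\Big(\frac{j-k}d\Big)\right],$$ and all the hypergeometric series here converge (also at $x=d^d$). The lower list consists of two sequences, with $j-1$ and $d-1-j$ terms; empty products are $1$. In particular $$W_2(x)=\frac1{2\pi}\sqrt{\frac{4-x}x},\qquad 0<x\le4,$$ $$W_3(x)=\frac{c_1(3)}{x^{1/3}}\,{}_2F_1\left({-\frac43,-\frac13\atop\frac43}\Big|\frac x{3^3}\right)+\frac{c_2(3)}{x^{2/3}}\,{}_2F_1\left({-\frac53,-\frac23\atop\frac23}\Big|\frac x{3^3}\right),\qquad 0<x\le 3^3,$$ $$W_4(x)=\frac{c_1(4)}{x^{1/4}}\,{}_3F_2\left({-\frac94,-\frac54,-\frac14\atop\frac54,\frac32}\Big|\frac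 x{4^4}\right)+\frac{c_2(4)}{x^{1/2}}\,{}_3F_2\left({-\frac52,-\frac32,-\frac12\atop\frac34,\frac54}\Big|\frac x{4^4}\right)+\frac{c_3(4)}{x^{3/4}}\,{}_3F_2\left({-\frac{11}4,-\frac74,-\frac34\atop\frac12,\frac34}\Big|\frac x{4^4}\right),\qquad 0<x\le 4^4,$$ and, for $0<x\le 5^5$, $$W_5(x)=\frac{c_1(5)}{x^{1/5}}\,{}_4F_3\left({-\frac{16}5,-\frac{11}5,-\frac65,-\frac15\atop\frac65,\frac75,\frac85}\Big|\frac x{5^5}\right)+\frac{c_2(5)}{x^{2/5}}\,{}_4F_3\left({-\frac{17}5,-\frac{12}5,-\frac75,-\frac25\atop\frac45,\frac65,\frac75}\Big|\frac x{5^5}\right)$$ $$\qquad+\frac{c_3(5)}{x^{3/5}}\,{}_4F_3\left({-\frac{18}5,-\frac{13}5,-\frac85,-\frac35\atop\frac35,\frac45,\frac65}\Big|\frac x{5^5}\right)+\frac{c_4(5)}{x^{4/5}}\,{}_4F_3\left({-\frac{19}5,-\frac{14}5,-\frac95,-\frac45\atop\frac25,\frac35,\frac45}\Big|\frac x{5^5}\right).$$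 -/

import Mathlib

open scoped Nat

noncomputable section

/-- The `d`-dimensional Catalan number
`C_d(n) = [∏_{p=0}^{d-1} p! / (n+p)!] (d n)!`, as a real number. -/
def catalanDim (d n : ℕ) : ℝ :=
  (∏ p ∈ Finset.range d, (p ! : ℝ) / ((n + p)! : ℝ)) * ((d * n)! : ℝ)

/-- `W` is a weight on `(0, R]` for the numbers `C_d(n)`: it is continuous on `(0, R]`, `R` is the
upper edge of its support, and its power moments exist and solve the Hausdorff moment problem
`∫_0^R x^n W(x) dx = C_d(n)` for all `n ≥ 0`. Values of `W` outside `(0, R]` play no role. -/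
structure IsCatalanWeight (d : ℕ) (R : ℝ) (W : ℝ → ℝ) : Prop where
  continuousOn : ContinuousOn W (Set.Ioc 0 R)
  isLUB_support : IsLUB {x : ℝ | x ∈ Set.Ioc 0 R ∧ W x ≠ 0} R
  integrableOn (n : ℕ) : MeasureTheory.IntegrableOn (fun x : ℝ => x ^ n * W x) (Set.Ioc 0 R)
  moment (n : ℕ) : ∫ x in Set.Ioc 0 R, x ^ n * W x = catalanDim d n

/-- The `k`-th term `(a_1)_k ⋯ (a_p)_k / ((b_1)_k ⋯ (b_q)_k) * z^k / k!` of the generalized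
hypergeometric series, where `(a)_k = a (a+1) ⋯ (a+k-1)`. -/
def hypTerm (a b : Multiset ℝ) (z : ℝ) (k : ℕ) : ℝ :=
  (a.map fun u => (ascPochhammer ℝ k).eval u).prod /
    (b.map fun u => (ascPochhammer ℝ k).eval u).prod * (z ^ k / (k ! : ℝ))

/-- The generalized hypergeometric function `_pF_q(a; b | z)` (real parameters and argument),
as the sum of its series. -/
def hypPFQ (a b : Multiset ℝ) (z : ℝ) : ℝ :=
  ∑' k : ℕ, hypTerm a b z k

/-- The `d - 1` upper parameters `-j/d, -1 - j/d, …, -(d-2) - j/d`. -/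
def upperParams (d j : ℕ) : Multiset ℝ :=
  (Multiset.range (d - 1)).map fun i => -(i : ℝ) - (j : ℝ) / (d : ℝ)

/-- The `d - 2` lower parameters
`1 - 1/d, …, 1 - (j-1)/d; 1 + 1/d, …, 1 + (d-j-1)/d`. -/
def lowerParams (d j : ℕ) : Multiset ℝ :=
  ((Multiset.range (j - 1)).map fun i => 1 - ((i : ℝ) + 1) / (d : ℝ)) +
    ((Multiset.range (d - j - 1)).map fun i => 1 + ((i : ℝ) + 1) / (d : ℝ))

/-- The coefficient
`c_j(d) = (2π)^{(1-d)/2} d^{j-d+1/2} [∏_{p=1}^{d-1} p!/Γ(p+j/d)] [∏_{k=1}^{j-1} Γ(k/d)]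
  [∏_{k=j+1}^{d-1} Γ((j-k)/d)]`. -/
def weightCoeff (d j : ℕ) : ℝ :=
  (2 * Real.pi) ^ ((1 - (d : ℝ)) / 2) * (d : ℝ) ^ ((j : ℝ) - (d : ℝ) + 1 / 2) *
    (∏ p ∈ Finset.Ico 1 d, (p ! : ℝ) / Real.Gamma ((p : ℝ) + (j : ℝ) / (d : ℝ))) *
    (∏ k ∈ Finset.Ico 1 j, Real.Gamma ((k : ℝ) / (d : ℝ))) *
    (∏ k ∈ Finset.Ico (j + 1) d, Real.Gamma (((j : ℝ) - (k : ℝ)) / (d : ℝ)))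

end

/-! Gauss's multiplication formula writes `C_d(n)` as a constant times `(d^d)^n` times
`∏_{l=1}^{d-1} Γ(n + a_l) / Γ(n + a_l + c_l)` with `a_l = l/d` and `c_l = l + 1 - l/d`
(`catalanDim_eq`). After scaling `x = d^d t`, everything reduces to finding the function of `t` on
`(0, 1]` with this product as moments. It is constructed in two ways.

Positivity: each factor is the moment sequence of a beta density, and multiplicative convolution of
densities multiplies moments, so an iterated convolution is a continuous weight, positive on `(0,
1)` (`exists_isUnitWeight_gammaRatio`).

Formula: as a function of `n` the product has only simple poles, at `-a_l - i`, because the `a_l`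
are distinct modulo `1`. It is the sum of its partial fractions (`gammaRatio_partialFractions`), and
`1 / (n + a_l + i)` is the `n`-th moment of `t^(a_l + i - 1)`. Hence the weight is a sum of `d - 1`
power series in `t`, each times a power of `t`. With `l = d - j` the residues are the hypergeometric
terms times their prefactor (`weightCoeff_mul_hypTerm`). Since `c_l > 1`, the residues are
absolutely summable, which gives convergence up to the right end point.

An integrable function on a bounded interval is determined almost everywhere by its moments
(Weierstrass). This identifies the two constructions, and also forces `R` and `W` for an arbitrary
weight (`IsCatalanWeight.unique`). -/

/-! ### The binomial series of a beta density -/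

/-- The coefficients of the binomial series of `(1 - x) ^ (c - 1) / Γ(c)`. -/
noncomputable def betaCoeff (c : ℝ) (k : ℕ) : ℝ :=
  (ascPochhammer ℝ k).eval (1 - c) / (k ! : ℝ) / Real.Gamma c

lemma betaCoeff_succ (c : ℝ) (k : ℕ) :
    ((k : ℝ) + 1) * betaCoeff c (k + 1) = ((k : ℝ) + 1 - c) * betaCoeff c k := by
  have hk : ((k : ℝ) + 1) ≠ 0 := by positivity
  have hf : (k ! : ℝ) ≠ 0 := by positivity
  simp only [betaCoeff, ascPochhammer_succ_eval, Nat.factorial_succ, Nat.cast_mul, Nat.cast_add,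
    Nat.cast_one, div_eq_mul_inv, mul_inv]
  field_simp
  ring

/-- Once `k > c`, the factor `k + 1 - c` in the recursion is positive, so `(c - 1) |b_k| = k |b_k| -
(k + 1) |b_(k+1)|`. The right side telescopes, which bounds the partial sums because `c - 1 > 0`. -/
lemma summable_betaCoeff {c : ℝ} (hc : 1 < c) : Summable (betaCoeff c) := by
  obtain ⟨K, hK⟩ := exists_nat_gt c
  rw [← summable_nat_add_iff K]
  refine Summable.of_norm ?_
  have step (k : ℕ) (hk : K ≤ k) :
      (c - 1) * |betaCoeff c k| = k * |betaCoeff c k| - (k + 1 : ℕ) * |betaCoeff c (k + 1)| := by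
    have h1 : (K : ℝ) ≤ k := by exact_mod_cast hk
    have h2 := congrArg abs (betaCoeff_succ c k)
    rw [abs_mul, abs_mul, abs_of_nonneg (by positivity : (0 : ℝ) ≤ (k : ℝ) + 1),
      abs_of_nonneg (by linarith : (0 : ℝ) ≤ (k : ℝ) + 1 - c)] at h2
    push_cast
    rw [h2]
    ring
  have bound (N : ℕ) : (c - 1) * ∑ i ∈ Finset.range N, |betaCoeff c (i + K)| =
      K * |betaCoeff c K| - (N + K : ℕ) * |betaCoeff c (N + K)| := by
    induction N with
    | zero => simp
    | succ N ih =>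
      rw [Finset.sum_range_succ, mul_add, ih, step _ (Nat.le_add_left K N),
        show N + 1 + K = N + K + 1 by ring]
      ring
  refine summable_of_sum_range_le (c := K * |betaCoeff c K| / (c - 1)) (fun _ => norm_nonneg _) ?_
  intro N
  rw [le_div_iff₀ (by linarith), mul_comm]
  simp only [Real.norm_eq_abs]
  rw [bound]
  have : 0 ≤ ((N + K : ℕ) : ℝ) * |betaCoeff c (N + K)| := by positivity
  linarith

lemma betaCoeff_mul_pow (c x : ℝ) (k : ℕ) :
    betaCoeff c k * x ^ k = Ring.choose (c - 1) k * (-x) ^ k / Real.Gamma c := by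
  have : Ring.choose (c - 1) k * (-1) ^ k = (ascPochhammer ℝ k).eval (1 - c) / (k ! : ℝ) := by
    rw [Ring.choose_eq_smul, Polynomial.descPochhammer_smeval_eq_ascPochhammer,
      Polynomial.ascPochhammer_smeval_cast, Polynomial.ascPochhammer_smeval_eq_eval,
      show (1 : ℝ) - c = -(c - 1) by ring, ascPochhammer_eval_neg_eq_descPochhammer,
      descPochhammer_eval_eq_ascPochhammer]
    simp
    ring
  rw [betaCoeff, ← this, neg_pow]
  ring

lemma hasSum_betaCoeff_mul_pow (c : ℝ) {x : ℝ} (h0 : 0 ≤ x) (h1 : x < 1) :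
    HasSum (fun k => betaCoeff c k * x ^ k) ((1 - x) ^ (c - 1) / Real.Gamma c) := by
  have h := (Real.one_add_rpow_hasFPowerSeriesOnBall_zero (a := c - 1)).hasSum (y := -x)
    (by simpa [Real.enorm_eq_ofReal_abs, abs_of_nonneg h0] using h1)
  simp only [binomialSeries_apply, List.ofFn_const, List.prod_replicate, smul_eq_mul,
    ← sub_eq_add_neg] at h
  rw [zero_sub, ← sub_eq_add_neg] at h
  simpa only [betaCoeff_mul_pow] using h.div_const (Real.Gamma c)

/-! ### Products of partial fraction series -/

lemma exists_pos_le_abs_sub_int {x : ℝ} (hx : ∀ n : ℤ, x ≠ n) :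
    ∃ δ > 0, ∀ n : ℤ, δ ≤ |x - n| :=
  ⟨|x - round x|, abs_pos.2 (sub_ne_zero.2 (hx _)), round_le x⟩

/-- For integer `x` the nonzero integers `x + n` have absolute value at least `1`; otherwise the
distance from `x` to the nearest integer serves. -/
lemma exists_pos_le_abs_add_nat {x : ℝ} (hx : ∀ n : ℕ, x + n ≠ 0) :
    ∃ δ > 0, ∀ n : ℕ, δ ≤ |x + n| := by
  by_cases h : ∃ m : ℤ, x = m
  · obtain ⟨m, rfl⟩ := h
    refine ⟨1, one_pos, fun n => ?_⟩
    have := hx n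
    norm_cast at this ⊢
    exact Int.one_le_abs this
  · push Not at h
    obtain ⟨δ, hδ, H⟩ := exists_pos_le_abs_sub_int h
    exact ⟨δ, hδ, fun n => by simpa using H (-n)⟩

lemma summable_div_of_le {ι : Type*} {r p : ι → ℝ} (hr : Summable r) {δ : ℝ} (hδ : 0 < δ)
    (hp : ∀ i, δ ≤ |p i|) : Summable fun i => r i / p i := by
  refine Summable.of_norm_bounded (hr.norm.mul_right δ⁻¹) fun i => ?_
  rw [norm_div, div_eq_mul_inv]
  have := hp i
  gcongr
  exact this

lemma abs_tsum_div_le {ι : Type*} {r p : ι → ℝ} (hr : Summable r) {δ : ℝ} (hδ : 0 < δ)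
    (hp : ∀ i, δ ≤ |p i|) : |∑' i, r i / p i| ≤ (∑' i, |r i|) * δ⁻¹ := by
  rw [← tsum_mul_right]
  rw [← Real.norm_eq_abs]
  refine tsum_of_norm_bounded (hr.norm.mul_right δ⁻¹).hasSum fun i => ?_
  rw [norm_div, div_eq_mul_inv]
  have := hp i
  gcongr
  exact this

/-- The product of two partial fraction expansions with disjoint sets of poles is the partial
fraction expansion whose residues are those of one factor times the values of the other. -/
lemma tsum_div_mul_tsum_div {ι κ : Type*} {r p : ι → ℝ} {u q : κ → ℝ} (hr : Summable r)
    (hu : Summable u) {s δ ε η : ℝ} (hδ : 0 < δ) (hε : 0 < ε) (hη : 0 < η)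
    (hp : ∀ i, δ ≤ |s + p i|) (hq : ∀ k, ε ≤ |s + q k|) (hpq : ∀ i k, η ≤ |q k - p i|) :
    (∑' i, r i / (s + p i)) * (∑' k, u k / (s + q k)) =
      ∑' i, r i * (∑' k, u k / (-p i + q k)) / (s + p i) +
        ∑' k, u k * (∑' i, r i / (-q k + p i)) / (s + q k) := by
  have h1 : Summable fun i => r i / (s + p i) := summable_div_of_le hr hδ hp
  have h2 : Summable fun k => u k / (s + q k) := summable_div_of_le hu hε hq
  have hf (i : ι) (k : κ) : s + p i ≠ 0 ∧ s + q k ≠ 0 ∧ q k - p i ≠ 0 :=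
    ⟨abs_pos.1 (hδ.trans_le (hp i)), abs_pos.1 (hε.trans_le (hq k)),
      abs_pos.1 (hη.trans_le (hpq i k))⟩
  -- Each half of the split product keeps only one of the denominators `s + p`, `s + q`; the other
  -- is replaced by `q - p`, bounded away from zero, so both double series converge absolutely and
  -- can be summed in either order.
  have m1 : Summable fun x : ι × κ => r x.1 / (s + p x.1) * u x.2 :=
    summable_mul_of_summable_norm (f := fun i => r i / (s + p i)) (g := u) h1.norm hu.norm
  have m2 : Summable fun x : ι × κ => r x.1 * (u x.2 / (s + q x.2)) :=
    summable_mul_of_summable_norm (f := r) (g := fun k => u k / (s + q k)) hr.norm h2.norm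
  have s1 : Summable fun x : ι × κ => (r x.1 / (s + p x.1) * u x.2) / (q x.2 - p x.1) :=
    summable_div_of_le m1 hη fun x => hpq x.1 x.2
  have s2 : Summable fun x : ι × κ => (r x.1 * (u x.2 / (s + q x.2))) / (p x.1 - q x.2) :=
    summable_div_of_le m2 hη fun x => (hpq x.1 x.2).trans_eq (abs_sub_comm _ _)
  rw [tsum_mul_tsum_of_summable_norm h1.norm h2.norm]
  have alg (a b P Q D : ℝ) (h1 : P ≠ 0) (h2 : Q ≠ 0) (h3 : D ≠ 0) (hD : D = Q - P) :
      a / P * (b / Q) = a / P * b / D + a * (b / Q) / -D := by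
    subst hD
    field_simp
    ring
  have e (x : ι × κ) : r x.1 / (s + p x.1) * (u x.2 / (s + q x.2)) =
      (r x.1 / (s + p x.1) * u x.2) / (q x.2 - p x.1) +
        (r x.1 * (u x.2 / (s + q x.2))) / (p x.1 - q x.2) := by
    obtain ⟨h1, h2, h3⟩ := hf x.1 x.2
    rw [← neg_sub (q x.2)]
    exact alg _ _ _ _ _ h1 h2 h3 (by ring)
  simp_rw [e]
  rw [s1.tsum_add s2, s1.tsum_prod, s2.tsum_prod]
  have e1 : ∑' i, ∑' k, (r i / (s + p i) * u k) / (q k - p i) =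
      ∑' i, r i * (∑' k, u k / (-p i + q k)) / (s + p i) := by
    refine tsum_congr fun i => ?_
    rw [mul_div_right_comm, ← tsum_mul_left]
    refine tsum_congr fun k => ?_
    rw [neg_add_eq_sub, mul_div_assoc]
  have s3 : Summable (Function.uncurry fun (i : ι) (k : κ) =>
      (r i * (u k / (s + q k))) / (p i - q k)) := s2
  have e2 : ∑' i, ∑' k, (r i * (u k / (s + q k))) / (p i - q k) =
      ∑' k, u k * (∑' i, r i / (-q k + p i)) / (s + q k) := by
    rw [← s3.tsum_comm]
    refine tsum_congr fun k => ?_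
    rw [mul_div_right_comm, ← tsum_mul_left]
    refine tsum_congr fun i => ?_
    rw [neg_add_eq_sub]
    ring
  rw [e1, e2]

/-! ### Power series on the unit interval and their moments -/

lemma continuousOn_tsum_mul_pow {r : ℕ → ℝ} (hr : Summable r) :
    ContinuousOn (fun x : ℝ => ∑' i, r i * x ^ i) (Set.Icc 0 1) := by
  refine continuousOn_tsum (fun i => by fun_prop) hr.norm fun i x hx => ?_
  rw [norm_mul, norm_pow, Real.norm_of_nonneg hx.1]
  exact mul_le_of_le_one_right (norm_nonneg _) (pow_le_one₀ hx.1 hx.2)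

lemma summable_mul_pow {r : ℕ → ℝ} (hr : Summable r) {x : ℝ} (h0 : 0 ≤ x) (h1 : x ≤ 1) :
    Summable fun i => r i * x ^ i := by
  refine Summable.of_norm_bounded hr.norm fun i => ?_
  rw [norm_mul, norm_pow, Real.norm_of_nonneg h0]
  exact mul_le_of_le_one_right (norm_nonneg _) (pow_le_one₀ h0 h1)

lemma integrableOn_rpow_Ioc {p : ℝ} (hp : 0 < p) :
    MeasureTheory.IntegrableOn (fun x : ℝ => x ^ (p - 1)) (Set.Ioc 0 1) :=
  (intervalIntegrable_iff_integrableOn_Ioc_of_le zero_le_one).1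
    (intervalIntegral.intervalIntegrable_rpow' (by linarith))

lemma setIntegral_rpow_Ioc {p : ℝ} (hp : 0 < p) :
    ∫ x in Set.Ioc (0 : ℝ) 1, x ^ (p - 1) = 1 / p := by
  rw [← intervalIntegral.integral_of_le zero_le_one, integral_rpow (Or.inl (by linarith))]
  simp [Real.zero_rpow hp.ne']

lemma integrableOn_rpow_mul_tsum {r : ℕ → ℝ} (hr : Summable r) {p : ℝ} (hp : 0 < p) :
    MeasureTheory.IntegrableOn (fun x : ℝ => x ^ (p - 1) * ∑' i, r i * x ^ i) (Set.Ioc 0 1) := by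
  refine MeasureTheory.Integrable.mul_bdd (c := ∑' i, ‖r i‖) (integrableOn_rpow_Ioc hp)
    (((continuousOn_tsum_mul_pow hr).mono Set.Ioc_subset_Icc_self).aestronglyMeasurable
      measurableSet_Ioc) ?_
  refine MeasureTheory.ae_restrict_of_forall_mem measurableSet_Ioc fun x hx => ?_
  refine tsum_of_norm_bounded hr.norm.hasSum fun i => ?_
  rw [norm_mul, norm_pow, Real.norm_of_nonneg hx.1.le]
  exact mul_le_of_le_one_right (norm_nonneg _) (pow_le_one₀ hx.1.le hx.2)

lemma setIntegral_rpow_mul_tsum {r : ℕ → ℝ} (hr : Summable r) {p : ℝ} (hp : 0 < p) :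
    ∫ x in Set.Ioc (0 : ℝ) 1, x ^ (p - 1) * ∑' i, r i * x ^ i = ∑' i, r i / (p + i) := by
  have hpi (i : ℕ) : 0 < p + i := by positivity
  have h := MeasureTheory.hasSum_integral_of_summable_integral_norm
    (μ := MeasureTheory.volume.restrict (Set.Ioc (0 : ℝ) 1))
    (F := fun (i : ℕ) (x : ℝ) => r i * x ^ (p + i - 1))
    (fun i => (integrableOn_rpow_Ioc (hpi i)).const_mul _) ?_
  · simp only [MeasureTheory.integral_const_mul, setIntegral_rpow_Ioc (hpi _), mul_one_div] at h
    rw [h.tsum_eq]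
    refine MeasureTheory.setIntegral_congr_fun measurableSet_Ioc fun x hx => ?_
    rw [← tsum_mul_left]
    refine tsum_congr fun i => ?_
    rw [add_sub_right_comm, Real.rpow_add_natCast hx.1.ne']
    ring
  -- The norms integrate to `|r i| / (p + i) ≤ |r i| / p`, which justifies termwise integration.
  · have e (i : ℕ) : ∫ x in Set.Ioc (0 : ℝ) 1, ‖r i * x ^ (p + i - 1)‖ = |r i| / (p + i) := by
      rw [← mul_one_div, ← setIntegral_rpow_Ioc (hpi i), ← MeasureTheory.integral_const_mul]
      refine MeasureTheory.setIntegral_congr_fun measurableSet_Ioc fun x hx => ?_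
      simp [abs_of_nonneg (Real.rpow_nonneg hx.1.le _)]
    simp_rw [e]
    refine summable_div_of_le hr.abs hp fun i => ?_
    rw [abs_of_pos (hpi i)]
    simp

/-! ### The beta integral and the partial fractions of a single gamma ratio -/

lemma integrableOn_beta {t c : ℝ} (ht : 0 < t) (hc : 0 < c) :
    MeasureTheory.IntegrableOn (fun x : ℝ => x ^ (t - 1) * (1 - x) ^ (c - 1)) (Set.Ioc 0 1) := by
  have h := Complex.betaIntegral_convergent (u := t) (v := c) (by simpa) (by simpa)
  rw [intervalIntegrable_iff_integrableOn_Ioc_of_le zero_le_one] at h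
  refine h.re.congr (MeasureTheory.ae_restrict_of_forall_mem measurableSet_Ioc fun x hx => ?_)
  have h1 : 0 ≤ 1 - x := by linarith [hx.2]
  have e : ((x : ℂ) ^ ((t : ℂ) - 1) * (1 - (x : ℂ)) ^ ((c : ℂ) - 1)) =
      ((x ^ (t - 1) * (1 - x) ^ (c - 1) : ℝ) : ℂ) := by
    rw [Complex.ofReal_mul, Complex.ofReal_cpow hx.1.le, Complex.ofReal_cpow h1]
    push_cast
    rfl
  dsimp only
  rw [e]
  rfl

lemma setIntegral_beta {t c : ℝ} (ht : 0 < t) (hc : 0 < c) :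
    ∫ x in Set.Ioc (0 : ℝ) 1, x ^ (t - 1) * (1 - x) ^ (c - 1) =
      Real.Gamma t * Real.Gamma c / Real.Gamma (t + c) := by
  have h := Complex.betaIntegral_eq_Gamma_mul_div (t : ℂ) c (by simpa) (by simpa)
  rw [Complex.betaIntegral, intervalIntegral.integral_of_le zero_le_one] at h
  have e : ∫ x in Set.Ioc (0 : ℝ) 1, (x : ℂ) ^ ((t : ℂ) - 1) * (1 - (x : ℂ)) ^ ((c : ℂ) - 1) =
      ∫ x in Set.Ioc (0 : ℝ) 1, ((x ^ (t - 1) * (1 - x) ^ (c - 1) : ℝ) : ℂ) := by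
    refine MeasureTheory.setIntegral_congr_fun measurableSet_Ioc fun x hx => ?_
    have h1 : 0 ≤ 1 - x := by linarith [hx.2]
    rw [Complex.ofReal_mul, Complex.ofReal_cpow hx.1.le, Complex.ofReal_cpow h1]
    push_cast
    rfl
  rw [e, integral_complex_ofReal, ← Complex.ofReal_add, Complex.Gamma_ofReal, Complex.Gamma_ofReal,
    Complex.Gamma_ofReal] at h
  exact_mod_cast h

lemma tsum_betaCoeff_div_of_pos {t c : ℝ} (ht : 0 < t) (hc : 1 < c) :
    ∑' k : ℕ, betaCoeff c k / (t + k) = Real.Gamma t / Real.Gamma (t + c) := by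
  have hc0 : 0 < c := by linarith
  have hG : Real.Gamma c ≠ 0 := (Real.Gamma_pos_of_pos hc0).ne'
  rw [← setIntegral_rpow_mul_tsum (summable_betaCoeff hc) ht]
  have e : ∫ x in Set.Ioc (0 : ℝ) 1, x ^ (t - 1) * ∑' k : ℕ, betaCoeff c k * x ^ k =
      ∫ x in Set.Ioc (0 : ℝ) 1, x ^ (t - 1) * (1 - x) ^ (c - 1) / Real.Gamma c := by
    -- The end point is dropped because the binomial expansion is available only for `x < 1`.
    rw [MeasureTheory.integral_Ioc_eq_integral_Ioo, MeasureTheory.integral_Ioc_eq_integral_Ioo]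
    refine MeasureTheory.setIntegral_congr_fun measurableSet_Ioo fun x hx => ?_
    rw [(hasSum_betaCoeff_mul_pow c hx.1.le hx.2).tsum_eq, mul_div_assoc]
  rw [e, MeasureTheory.integral_div, setIntegral_beta ht hc0]
  field_simp

/-- This is the functional equation satisfied by `Γ(t) / Γ(t + c)`. By the recursion for the
coefficients, the difference of the two sides telescopes along `u k = k b_k / (t + k)`, and `u 0 =
0`. -/
lemma tsum_betaCoeff_div_succ {t c : ℝ} (hc : 1 < c) (ht : ∀ k : ℕ, t + k ≠ 0) :
    (t + c) * ∑' k : ℕ, betaCoeff c k / (t + 1 + k) = t * ∑' k : ℕ, betaCoeff c k / (t + k) := by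
  obtain ⟨δ, hδ, H⟩ := exists_pos_le_abs_add_nat ht
  have hb := summable_betaCoeff hc
  have s0 : Summable fun k : ℕ => betaCoeff c k / (t + k) := summable_div_of_le hb hδ H
  have s1 : Summable fun k : ℕ => betaCoeff c k / (t + 1 + k) :=
    summable_div_of_le hb hδ fun k => by
      simpa [add_assoc, add_comm, add_left_comm] using H (k + 1)
  set u : ℕ → ℝ := fun k => betaCoeff c k - t * (betaCoeff c k / (t + k)) with hu
  have hsu : Summable u := hb.sub (s0.mul_left t)
  have key (k : ℕ) : (t + c) * (betaCoeff c k / (t + 1 + k)) - t * (betaCoeff c k / (t + k)) =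
      u k - u (k + 1) := by
    have h0 := ht k
    have h1 : t + 1 + k ≠ 0 := by have := ht (k + 1); push_cast at this; rwa [add_assoc, add_comm 1]
    have hs := betaCoeff_succ c k
    have h3 : t + ((k : ℝ) + 1) = t + 1 + k := by ring
    simp only [hu, Nat.cast_add, Nat.cast_one, h3]
    have e1 : betaCoeff c (k + 1) - t * (betaCoeff c (k + 1) / (t + 1 + k)) =
        ((k : ℝ) + 1 - c) * betaCoeff c k / (t + 1 + k) := by
      rw [← hs]
      field_simp
      ring
    rw [e1]
    field_simp
    ring
  have hu0 : u 0 = 0 := by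
    have := ht 0
    simp only [Nat.cast_zero, add_zero] at this
    simp only [hu, Nat.cast_zero, add_zero]
    field_simp
    ring
  rw [← sub_eq_zero, ← tsum_mul_left, ← tsum_mul_left,
    ← (s1.mul_left _).tsum_sub (s0.mul_left _)]
  simp_rw [key]
  rw [hsu.tsum_sub ((summable_nat_add_iff 1).2 hsu), hsu.tsum_eq_zero_add, hu0]
  ring

/-- The beta integral gives the case `t > 0`; the functional equation carries it from `t + 1` down
to `t`, one unit at a time. -/
lemma tsum_betaCoeff_div {t c : ℝ} (hc : 1 < c) (ht : ∀ k : ℕ, t + k ≠ 0) :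
    ∑' k : ℕ, betaCoeff c k / (t + k) = Real.Gamma t / Real.Gamma (t + c) := by
  obtain ⟨N, hN⟩ := exists_nat_gt (-t)
  have : 0 < t + N := by linarith
  clear hN
  induction N generalizing t with
  | zero => exact tsum_betaCoeff_div_of_pos (by simpa using this) hc
  | succ N ih =>
    have h0 : t ≠ 0 := by simpa using ht 0
    have ih' := ih (t := t + 1) (fun k => by
        have := ht (k + 1)
        push_cast at this
        rwa [add_assoc, add_comm 1])
      (by push_cast at this; linarith)
    have h := tsum_betaCoeff_div_succ hc ht
    rw [ih', Real.Gamma_add_one h0] at h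
    refine mul_left_cancel₀ h0 (h.symm.trans ?_)
    -- At `t + c = 0` both sides vanish: the right one because `Real.Gamma 0 = 0` and division by
    -- zero is zero, matching the true zero of `1 / Γ`.
    by_cases h1 : t + c = 0
    · rw [h1, Real.Gamma_zero]
      simp
    · rw [add_right_comm, Real.Gamma_add_one h1, mul_div_assoc, mul_left_comm]
      field_simp

/-! ### Partial fractions of a product of gamma ratios -/

/-- The product `∏_{l ∈ S} Γ(s + a_l) / Γ(s + a_l + c_l)`. -/
noncomputable def gammaRatio (a c : ℕ → ℝ) (S : Finset ℕ) (s : ℝ) : ℝ :=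
  ∏ l ∈ S, Real.Gamma (s + a l) / Real.Gamma (s + a l + c l)

/-- The residue of `gammaRatio a c S` at the pole `-a_l - i`. -/
noncomputable def gammaRes (a c : ℕ → ℝ) (S : Finset ℕ) (l i : ℕ) : ℝ :=
  betaCoeff (c l) i * gammaRatio a c (S.erase l) (-(a l + i))

lemma gammaRatio_insert (a c : ℕ → ℝ) {S : Finset ℕ} {m : ℕ} (hm : m ∉ S) (s : ℝ) :
    gammaRatio a c (insert m S) s =
      Real.Gamma (s + a m) / Real.Gamma (s + a m + c m) * gammaRatio a c S s :=
  Finset.prod_insert hm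

lemma gammaRes_insert_self (a c : ℕ → ℝ) {S : Finset ℕ} {m : ℕ} (hm : m ∉ S) (i : ℕ) :
    gammaRes a c (insert m S) m i = betaCoeff (c m) i * gammaRatio a c S (-(a m + i)) := by
  rw [gammaRes, Finset.erase_insert hm]

lemma gammaRes_insert_of_mem (a c : ℕ → ℝ) {S : Finset ℕ} {m l : ℕ} (hm : m ∉ S) (hl : l ∈ S)
    (i : ℕ) :
    gammaRes a c (insert m S) l i = gammaRes a c S l i *
      (Real.Gamma (-(a l + i) + a m) / Real.Gamma (-(a l + i) + a m + c m)) := by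
  have hml : m ≠ l := fun h => hm (h ▸ hl)
  rw [gammaRes, gammaRes, Finset.erase_insert_of_ne hml,
    gammaRatio_insert _ _ (fun h => hm (Finset.mem_of_mem_erase h))]
  ring

/-- The partial fraction expansion of `gammaRatio`. -/
theorem gammaRatio_partialFractions (a c : ℕ → ℝ) {S : Finset ℕ} (hS : S.Nonempty)
    (hc : ∀ l ∈ S, 1 < c l) (ha : ∀ l ∈ S, ∀ m ∈ S, l ≠ m → ∀ n : ℤ, a l - a m ≠ n) :
    (∀ l ∈ S, Summable (gammaRes a c S l)) ∧
      ∀ s : ℝ, (∀ l ∈ S, ∀ i : ℕ, s + a l + i ≠ 0) →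
        gammaRatio a c S s = ∑ l ∈ S, ∑' i : ℕ, gammaRes a c S l i / (s + (a l + i)) := by
  induction hS using Finset.Nonempty.cons_induction with
  | singleton m =>
    have hr : gammaRes a c {m} m = betaCoeff (c m) := by
      funext i
      simp [gammaRes, gammaRatio]
    have hcm := hc m (Finset.mem_singleton_self m)
    refine ⟨fun l hl => ?_, fun s hs => ?_⟩
    · obtain rfl := Finset.mem_singleton.1 hl
      rw [hr]
      exact summable_betaCoeff hcm
    · rw [Finset.sum_singleton, hr]
      simp only [← add_assoc]
      rw [tsum_betaCoeff_div hcm (hs m (Finset.mem_singleton_self m))]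
      simp [gammaRatio]
  | cons m S hm hS ih =>
    rw [Finset.cons_eq_insert] at *
    obtain ⟨ih1, ih2⟩ := ih (fun l hl => hc l (Finset.mem_insert_of_mem hl))
      (fun l hl k hk => ha l (Finset.mem_insert_of_mem hl) k (Finset.mem_insert_of_mem hk))
    have hcm := hc m (Finset.mem_insert_self m S)
    have hb := summable_betaCoeff hcm
    -- Since `a m - a l` is not an integer, the two progressions of poles stay a positive distance
    -- apart.
    have hsep (l : ℕ) (hl : l ∈ S) : ∃ η > 0, ∀ i k : ℕ, η ≤ |(a m + k) - (a l + i)| := by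
      obtain ⟨η, hη, H⟩ := exists_pos_le_abs_sub_int (ha m (Finset.mem_insert_self m S) l
        (Finset.mem_insert_of_mem hl) (fun h => hm (h ▸ hl)))
      refine ⟨η, hη, fun i k => (H (i - k)).trans_eq (congrArg abs ?_)⟩
      push_cast
      ring
    -- The new factor at an old pole, and below the old product at a new pole, are given by their
    -- own expansions; these values multiply the residues when the expansions are multiplied.
    have hB (l : ℕ) (hl : l ∈ S) (i : ℕ) :
        ∑' k : ℕ, betaCoeff (c m) k / (-(a l + i) + (a m + k)) =
          Real.Gamma (-(a l + i) + a m) / Real.Gamma (-(a l + i) + a m + c m) := by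
      obtain ⟨η, hη, H⟩ := hsep l hl
      rw [← tsum_betaCoeff_div hcm]
      · simp only [add_assoc]
      · intro k h0
        have := H i k
        rw [show (a m + k) - (a l + i) = -(a l + i) + a m + k by ring, h0, abs_zero] at this
        linarith
    have hG (k : ℕ) : gammaRatio a c S (-(a m + k)) =
        ∑ l ∈ S, ∑' i : ℕ, gammaRes a c S l i / (-(a m + k) + (a l + i)) := by
      refine ih2 _ fun l hl i h0 => ?_
      obtain ⟨η, hη, H⟩ := hsep l hl
      have := H i k
      rw [show (a m + k) - (a l + i) = -(-(a m + k) + a l + i) by ring, h0, neg_zero,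
        abs_zero] at this
      linarith
    -- By the separation of poles, the old product is bounded along the new poles, so the new
    -- residues inherit summability from `betaCoeff`.
    have hmS : Summable (gammaRes a c (insert m S) m) := by
      choose! η hη H using hsep
      refine Summable.of_norm_bounded
        (hb.norm.mul_right (∑ l ∈ S, (∑' i, |gammaRes a c S l i|) * (η l)⁻¹)) fun k => ?_
      rw [gammaRes_insert_self _ _ hm, norm_mul, hG]
      refine mul_le_mul_of_nonneg_left ?_ (norm_nonneg _)
      refine norm_sum_le_of_le _ fun l hl => ?_
      refine abs_tsum_div_le (ih1 l hl) (hη l hl) fun i => ?_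
      rw [neg_add_eq_sub, abs_sub_comm]
      exact H l hl i k
    refine ⟨fun l hl => ?_, fun s hs => ?_⟩
    · rcases Finset.mem_insert.1 hl with rfl | hl
      · exact hmS
      · obtain ⟨η, hη, H⟩ := hsep l hl
        refine Summable.of_norm_bounded
          ((ih1 l hl).norm.mul_right ((∑' k, |betaCoeff (c m) k|) * η⁻¹)) fun i => ?_
        rw [gammaRes_insert_of_mem _ _ hm hl, norm_mul, ← hB l hl]
        refine mul_le_mul_of_nonneg_left ?_ (norm_nonneg _)
        refine abs_tsum_div_le hb hη fun k => ?_
        rw [neg_add_eq_sub]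
        exact H i k
    · obtain ⟨ε, hε, Hε⟩ := exists_pos_le_abs_add_nat (hs m (Finset.mem_insert_self m S))
      simp only [add_assoc] at Hε
      have e0 : Real.Gamma (s + a m) / Real.Gamma (s + a m + c m) =
          ∑' k : ℕ, betaCoeff (c m) k / (s + (a m + k)) := by
        rw [← tsum_betaCoeff_div hcm (hs m (Finset.mem_insert_self m S))]
        simp only [add_assoc]
      rw [gammaRatio_insert _ _ hm, ih2 s fun l hl => hs l (Finset.mem_insert_of_mem hl),
        Finset.sum_insert hm, mul_comm, Finset.sum_mul]
      have e1 (l : ℕ) (hl : l ∈ S) :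
          (∑' i : ℕ, gammaRes a c S l i / (s + (a l + i))) *
            (Real.Gamma (s + a m) / Real.Gamma (s + a m + c m)) =
          ∑' i : ℕ, gammaRes a c (insert m S) l i / (s + (a l + i)) +
            ∑' k : ℕ, betaCoeff (c m) k *
              (∑' i : ℕ, gammaRes a c S l i / (-(a m + k) + (a l + i))) / (s + (a m + k)) := by
        obtain ⟨η, hη, H⟩ := hsep l hl
        obtain ⟨δ, hδ, Hδ⟩ := exists_pos_le_abs_add_nat (hs l (Finset.mem_insert_of_mem hl))
        simp only [add_assoc] at Hδ
        rw [e0, tsum_div_mul_tsum_div (p := fun i : ℕ => a l + i) (q := fun k : ℕ => a m + k)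
          (ih1 l hl) hb hδ hε hη Hδ Hε H]
        simp only [hB l hl, gammaRes_insert_of_mem _ _ hm hl]
      rw [Finset.sum_congr rfl e1, Finset.sum_add_distrib, add_comm]
      congr 1
      simp only [gammaRes_insert_self _ _ hm, hG, Finset.mul_sum, Finset.sum_div]
      refine (Summable.tsum_finsetSum fun l hl => ?_).symm
      obtain ⟨η, hη, H⟩ := hsep l hl
      refine summable_div_of_le ?_ hε Hε
      refine Summable.of_norm_bounded
        (hb.norm.mul_right ((∑' i, |gammaRes a c S l i|) * η⁻¹)) fun k => ?_
      rw [norm_mul]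
      refine mul_le_mul_of_nonneg_left ?_ (norm_nonneg _)
      refine abs_tsum_div_le (ih1 l hl) hη fun i => ?_
      rw [neg_add_eq_sub, abs_sub_comm]
      exact H i k

/-! ### Uniqueness in the Hausdorff moment problem -/

open MeasureTheory Set in
/-- An integrable function on `(0, M]` whose power moments all vanish is zero almost everywhere. -/
lemma ae_eq_zero_of_moments_eq_zero {f : ℝ → ℝ} {M : ℝ} (hf : IntegrableOn f (Ioc 0 M))
    (hm : ∀ n : ℕ, ∫ x in Ioc 0 M, x ^ n * f x = 0) : f =ᵐ[volume.restrict (Ioc 0 M)] 0 := by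
  have hF : Integrable ((Ioc 0 M).indicator f) := (integrable_indicator_iff measurableSet_Ioc).2 hf
  have h0 : ∀ᵐ x, (Ioc 0 M).indicator f x = 0 := by
    refine ae_eq_zero_of_integral_contDiff_smul_eq_zero hF.locallyIntegrable fun g hg _ => ?_
    have e : ∫ x, g x • (Ioc 0 M).indicator f x = ∫ x in Ioc 0 M, g x * f x := by
      rw [← integral_indicator measurableSet_Ioc]
      refine integral_congr_ae (Filter.Eventually.of_forall fun x => ?_)
      by_cases hx : x ∈ Ioc 0 M <;> simp [hx]
    rw [e]
    have hcont (q : ℝ → ℝ) (hq : Continuous q) : IntegrableOn (fun x => q x * f x) (Ioc 0 M) := by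
      obtain ⟨C, hC⟩ := (isCompact_Icc (a := (0 : ℝ)) (b := M)).exists_bound_of_continuousOn
        hq.continuousOn
      exact hf.bdd_mul (c := C) hq.aestronglyMeasurable
        (ae_restrict_of_forall_mem measurableSet_Ioc fun x hx => hC x (Ioc_subset_Icc_self hx))
    have hpoly (p : Polynomial ℝ) : ∫ x in Ioc 0 M, p.eval x * f x = 0 := by
      simp only [Polynomial.eval_eq_sum_range, Finset.sum_mul, mul_assoc]
      rw [integral_finsetSum _ fun i _ =>
        (hcont (fun x => x ^ i) (by fun_prop)).const_mul (p.coeff i)]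
      simp [integral_const_mul, hm]
    -- Weierstrass: a polynomial within `ε` of the test function integrates to zero against `f`.
    have hbound (ε : ℝ) (hε : 0 < ε) :
        |∫ x in Ioc 0 M, g x * f x| ≤ ε * ∫ x in Ioc 0 M, |f x| := by
      obtain ⟨p, hp⟩ := exists_polynomial_near_of_continuousOn 0 M g hg.continuous.continuousOn ε hε
      have e2 : ∫ x in Ioc 0 M, g x * f x =
          (∫ x in Ioc 0 M, g x * f x) - ∫ x in Ioc 0 M, p.eval x * f x := by rw [hpoly, sub_zero]
      rw [e2, ← integral_sub (hcont g hg.continuous) (hcont (fun x => p.eval x) p.continuous),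
        ← integral_const_mul]
      rw [← Real.norm_eq_abs]
      refine norm_integral_le_of_norm_le (Integrable.const_mul hf.abs ε) ?_
      refine ae_restrict_of_forall_mem measurableSet_Ioc fun x hx => ?_
      rw [← sub_mul, norm_mul, Real.norm_eq_abs, Real.norm_eq_abs, abs_sub_comm]
      exact mul_le_mul_of_nonneg_right (hp x (Ioc_subset_Icc_self hx)).le (abs_nonneg _)
    have hI : 0 ≤ ∫ x in Ioc 0 M, |f x| := integral_nonneg fun _ => abs_nonneg _
    refine abs_nonpos_iff.1 (le_of_forall_pos_le_add fun δ hδ => ?_)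
    refine (hbound (δ / ((∫ x in Ioc 0 M, |f x|) + 1)) (by positivity)).trans ?_
    rw [zero_add, div_mul_eq_mul_div, div_le_iff₀ (by positivity)]
    nlinarith
  refine (ae_restrict_iff' measurableSet_Ioc).2 (h0.mono fun x hx hxm => ?_)
  simpa [hxm] using hx

open MeasureTheory Set in
lemma eqOn_Ioc_of_moments_eq {f g : ℝ → ℝ} {R : ℝ} (hf : ContinuousOn f (Ioc 0 R))
    (hg : ContinuousOn g (Ioc 0 R)) (hfi : ∀ n : ℕ, IntegrableOn (fun x => x ^ n * f x) (Ioc 0 R))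
    (hgi : ∀ n : ℕ, IntegrableOn (fun x => x ^ n * g x) (Ioc 0 R))
    (h : ∀ n : ℕ, ∫ x in Ioc 0 R, x ^ n * f x = ∫ x in Ioc 0 R, x ^ n * g x) :
    EqOn f g (Ioc 0 R) := by
  have h0 := ae_eq_zero_of_moments_eq_zero (f := fun x => f x - g x) (M := R)
    (by simpa [Pi.sub_def] using (hfi 0).sub (hgi 0)) fun n => by
      simp only [mul_sub]
      rw [integral_sub (hfi n) (hgi n), h, sub_self]
  exact Measure.eqOn_Ioc_of_ae_eq volume (h0.mono fun x hx => sub_eq_zero.1 hx) hf hg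

lemma IsCatalanWeight.pos {d : ℕ} {R : ℝ} {W : ℝ → ℝ} (h : IsCatalanWeight d R W) : 0 < R := by
  obtain ⟨x, hx, -⟩ := h.isLUB_support.nonempty
  exact hx.1.trans_le hx.2

-- If `R < R'`, extending `W` by zero gives a function on `(0, R']` with the same moments as `W'`.
-- So `W'` vanishes on `(R, R']`, and `R'` is not the upper edge of its support.
open MeasureTheory Set in
lemma IsCatalanWeight.le {d : ℕ} {R R' : ℝ} {W W' : ℝ → ℝ} (h : IsCatalanWeight d R W)
    (h' : IsCatalanWeight d R' W') : R' ≤ R := by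
  by_contra! hlt
  have hsub : Ioc 0 R ⊆ Ioc 0 R' := Ioc_subset_Ioc_right hlt.le
  have e (n : ℕ) : (fun x => x ^ n * (Ioc 0 R).indicator W x) =
      (Ioc 0 R).indicator fun x => x ^ n * W x := by
    funext x
    by_cases hx : x ∈ Ioc 0 R <;> simp [hx]
  have hi (n : ℕ) : IntegrableOn (fun x => x ^ n * (Ioc 0 R).indicator W x) (Ioc 0 R') := by
    rw [e]
    exact ((integrable_indicator_iff measurableSet_Ioc).2 (h.integrableOn n)).integrableOn
  have hm (n : ℕ) : ∫ x in Ioc 0 R', x ^ n * (Ioc 0 R).indicator W x = catalanDim d n := by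
    rw [e, setIntegral_indicator measurableSet_Ioc, inter_eq_self_of_subset_right hsub, h.moment]
  have h0 := ae_eq_zero_of_moments_eq_zero (f := fun x => (Ioc 0 R).indicator W x - W' x) (M := R')
    (by simpa [Pi.sub_def] using (hi 0).sub (h'.integrableOn 0)) fun n => by
      simp only [mul_sub]
      rw [integral_sub (hi n) (h'.integrableOn n), hm, h'.moment, sub_self]
  have hsub' : Ioc R R' ⊆ Ioc 0 R' := Ioc_subset_Ioc_left h.pos.le
  have h1 : W' =ᵐ[volume.restrict (Ioc R R')] fun _ => 0 := by
    filter_upwards [ae_restrict_of_ae_restrict_of_subset hsub' h0,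
      ae_restrict_mem measurableSet_Ioc] with x hx hxm
    simpa [hxm.1] using hx
  have h2 := Measure.eqOn_Ioc_of_ae_eq volume h1 (h'.continuousOn.mono hsub') continuousOn_const
  refine absurd (h'.isLUB_support.2 (show R ∈ upperBounds _ from ?_)) hlt.not_ge
  rintro x ⟨hx, hW⟩
  by_contra! hRx
  exact hW (h2 ⟨hRx, hx.2⟩)

lemma IsCatalanWeight.unique {d : ℕ} {R R' : ℝ} {W W' : ℝ → ℝ} (h : IsCatalanWeight d R W)
    (h' : IsCatalanWeight d R' W') : R = R' ∧ Set.EqOn W W' (Set.Ioc 0 R) := by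
  obtain rfl := le_antisymm (h'.le h) (h.le h')
  exact ⟨rfl, eqOn_Ioc_of_moments_eq h.continuousOn h'.continuousOn h.integrableOn h'.integrableOn
    fun n => by rw [h.moment, h'.moment]⟩

/-! ### Positive weights by multiplicative convolution -/

/-- `w` is continuous on `(0, ∞)`, positive on `(0, 1)`, zero on `[1, ∞)` and has power moments
`m`. -/
structure IsUnitWeight (w : ℝ → ℝ) (m : ℕ → ℝ) : Prop where
  continuousOn : ContinuousOn w (Set.Ioi 0)
  eq_zero {x : ℝ} (hx : 1 ≤ x) : w x = 0
  pos {x : ℝ} (h0 : 0 < x) (h1 : x < 1) : 0 < w x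
  integrableOn (n : ℕ) : MeasureTheory.IntegrableOn (fun x : ℝ => x ^ n * w x) (Set.Ioi 0)
  moment (n : ℕ) : ∫ x in Set.Ioi (0 : ℝ), x ^ n * w x = m n

section UnitWeight

open MeasureTheory Set

lemma IsUnitWeight.nonneg {w : ℝ → ℝ} {m : ℕ → ℝ} (h : IsUnitWeight w m) {x : ℝ} (hx : 0 < x) :
    0 ≤ w x := by
  rcases lt_or_ge x 1 with h1 | h1
  · exact (h.pos hx h1).le
  · exact (h.eq_zero h1).ge

lemma IsUnitWeight.exists_bound {w : ℝ → ℝ} {m : ℕ → ℝ} (h : IsUnitWeight w m) {ε : ℝ}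
    (hε : 0 < ε) : ∃ C, 0 ≤ C ∧ ∀ x, ε ≤ x → |w x| ≤ C := by
  obtain ⟨C, hC⟩ := (isCompact_Icc (a := ε) (b := 1)).exists_bound_of_continuousOn
    (h.continuousOn.mono fun x hx => hε.trans_le hx.1)
  refine ⟨max C 0, le_max_right _ _, fun x hx => ?_⟩
  rcases le_or_gt x 1 with h1 | h1
  · exact (hC x ⟨hx, h1⟩).trans (le_max_left _ _)
  · rw [h.eq_zero h1.le, abs_zero]
    exact le_max_right _ _

lemma IsUnitWeight.congr_moment {w : ℝ → ℝ} {m m' : ℕ → ℝ} (h : IsUnitWeight w m)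
    (hm : ∀ n, m n = m' n) : IsUnitWeight w m' := by
  rwa [← funext hm]

/-- The density of a product of independent variables with densities `w` and `b` on `(0, ∞)`. -/
noncomputable def mulConv (w b : ℝ → ℝ) (x : ℝ) : ℝ :=
  ∫ y in Ioi (0 : ℝ), w y * (b (x / y) / y)

variable {w b : ℝ → ℝ} {m m' : ℕ → ℝ}

/-- The integrand vanishes unless `x < y < 1`, where `x / y ≥ ε` and `1 / y ≤ 1 / ε`. The bound is
uniform in `x ≥ ε`, hence serves as dominating function for continuity. -/
lemma abs_mulConv_integrand_le (hw : IsUnitWeight w m) (hb : IsUnitWeight b m')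
    {ε C x y : ℝ} (hε : 0 < ε) (hC0 : 0 ≤ C) (hC : ∀ x, ε ≤ x → |b x| ≤ C) (hx : ε ≤ x)
    (hy : 0 < y) : ‖w y * (b (x / y) / y)‖ ≤ |w y| * (C / ε) := by
  rw [norm_mul, Real.norm_eq_abs, Real.norm_eq_abs]
  rcases le_or_gt 1 y with h1 | h1
  · simp [hw.eq_zero h1]
  refine mul_le_mul_of_nonneg_left ?_ (abs_nonneg _)
  rcases le_or_gt y x with h2 | h2
  · rw [hb.eq_zero ((one_le_div hy).2 h2), zero_div, abs_zero]
    positivity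
  · rw [abs_div, abs_of_pos hy]
    refine div_le_div₀ hC0 (hC _ (hx.trans ?_)) hε (hx.trans h2.le)
    rw [le_div_iff₀ hy]
    exact mul_le_of_le_one_right (hε.le.trans hx) h1.le

lemma continuousOn_div_const_comp (hb : IsUnitWeight b m') :
    ContinuousOn (fun z : ℝ × ℝ => b (z.1 / z.2) / z.2) (Ioi 0 ×ˢ Ioi 0) := by
  have hne : ∀ z ∈ (Ioi (0 : ℝ) ×ˢ Ioi (0 : ℝ)), z.2 ≠ 0 := fun z hz => ne_of_gt hz.2
  refine ContinuousOn.div ?_ continuousOn_snd hne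
  exact hb.continuousOn.comp (continuousOn_fst.div continuousOn_snd hne)
    fun z hz => mem_Ioi.2 (div_pos hz.1 hz.2)

lemma mulConv_integrand_aestronglyMeasurable (hw : IsUnitWeight w m) (hb : IsUnitWeight b m')
    {x : ℝ} (hx : 0 < x) :
    AEStronglyMeasurable (fun y => w y * (b (x / y) / y)) (volume.restrict (Ioi 0)) :=
  (hw.continuousOn.mul ((continuousOn_div_const_comp hb).comp
    (f := fun y : ℝ => (x, y)) (by fun_prop) fun _ hy => ⟨hx, hy⟩)).aestronglyMeasurable
      measurableSet_Ioi

lemma IsUnitWeight.integrable (hw : IsUnitWeight w m) : IntegrableOn w (Ioi 0) := by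
  simpa using hw.integrableOn 0

lemma mulConv_integrand_integrableOn (hw : IsUnitWeight w m) (hb : IsUnitWeight b m')
    {x : ℝ} (hx : 0 < x) : IntegrableOn (fun y => w y * (b (x / y) / y)) (Ioi 0) := by
  obtain ⟨C, hC0, hC⟩ := hb.exists_bound hx
  exact Integrable.mono' (Integrable.mul_const hw.integrable.abs (C / x))
    (mulConv_integrand_aestronglyMeasurable hw hb hx)
    (ae_restrict_of_forall_mem measurableSet_Ioi fun y hy =>
      abs_mulConv_integrand_le hw hb hx hC0 hC le_rfl hy)

lemma continuousOn_mulConv (hw : IsUnitWeight w m) (hb : IsUnitWeight b m') :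
    ContinuousOn (mulConv w b) (Ioi 0) := by
  intro x₀ (hx₀ : 0 < x₀)
  refine ContinuousAt.continuousWithinAt ?_
  obtain ⟨C, hC0, hC⟩ := hb.exists_bound (half_pos hx₀)
  have hnear : ∀ᶠ x in nhds x₀, x₀ / 2 ≤ x := Ici_mem_nhds (by linarith)
  refine continuousAt_of_dominated (bound := fun y => |w y| * (C / (x₀ / 2)))
    (hnear.mono fun x hx =>
      mulConv_integrand_aestronglyMeasurable hw hb ((half_pos hx₀).trans_le hx))
    (hnear.mono fun x hx => ae_restrict_of_forall_mem measurableSet_Ioi fun y hy =>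
      abs_mulConv_integrand_le hw hb (half_pos hx₀) hC0 hC hx hy)
    (Integrable.mul_const hw.integrable.abs _)
    (ae_restrict_of_forall_mem measurableSet_Ioi fun y hy => ?_)
  have hc : ContinuousAt b (x₀ / y) := hb.continuousOn.continuousAt (Ioi_mem_nhds (div_pos hx₀ hy))
  have hd : ContinuousAt (fun x : ℝ => x / y) x₀ := by fun_prop
  exact continuousAt_const.mul ((ContinuousAt.comp (f := fun x : ℝ => x / y) hc hd).div_const y)

lemma mulConv_eq_zero (hw : IsUnitWeight w m) (hb : IsUnitWeight b m') {x : ℝ} (hx : 1 ≤ x) :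
    mulConv w b x = 0 := by
  refine setIntegral_eq_zero_of_forall_eq_zero fun y (hy : 0 < y) => ?_
  rcases le_or_gt 1 y with h1 | h1
  · simp [hw.eq_zero h1]
  · simp [hb.eq_zero ((one_le_div hy).2 (h1.le.trans hx))]

lemma mulConv_pos (hw : IsUnitWeight w m) (hb : IsUnitWeight b m') {x : ℝ} (h0 : 0 < x)
    (h1 : x < 1) : 0 < mulConv w b x := by
  rw [mulConv, setIntegral_pos_iff_support_of_nonneg_ae
    (ae_restrict_of_forall_mem measurableSet_Ioi fun y (hy : 0 < y) =>
      mul_nonneg (hw.nonneg hy) (div_nonneg (hb.nonneg (div_pos h0 hy)) hy.le))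
    (mulConv_integrand_integrableOn hw hb h0)]
  -- The integrand is positive for `y` in `(x, 1)`, an interval of positive length.
  refine (Measure.measure_Ioo_pos volume |>.2 h1).trans_le (measure_mono fun y hy => ?_)
  have hy0 : 0 < y := h0.trans hy.1
  exact ⟨(mul_pos (hw.pos hy0 hy.2) (div_pos (hb.pos (div_pos h0 hy0)
    ((div_lt_one hy0).2 hy.1)) hy0)).ne', hy0⟩

/-- Prepares the substitution `u = x / y`, which separates the two moments in Fubini's theorem. -/
lemma mulConv_inner_eq (n : ℕ) {x y : ℝ} (hy : 0 < y) : x ^ n * (w y * (b (x / y) / y)) =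
    y ^ n * w y / y * ((fun u => u ^ n * b u) (y⁻¹ * x)) := by
  have hx : x = y * (y⁻¹ * x) := by field_simp
  have e : x / y = y⁻¹ * x := by ring
  simp only [e]
  conv_lhs => rw [hx, mul_pow, ← hx]
  ring

lemma integral_mulConv_inner (hb : IsUnitWeight b m') (n : ℕ) {y : ℝ} (hy : 0 < y) :
    IntegrableOn (fun x => x ^ n * (w y * (b (x / y) / y))) (Ioi 0) ∧
      ∫ x in Ioi (0 : ℝ), x ^ n * (w y * (b (x / y) / y)) = y ^ n * w y * m' n := by
  simp only [mulConv_inner_eq n hy]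
  constructor
  · refine Integrable.const_mul ?_ _
    refine (integrableOn_Ioi_comp_mul_left_iff (fun u => u ^ n * b u) 0 (inv_pos.2 hy)).2 ?_
    rw [mul_zero]
    exact hb.integrableOn n
  · rw [integral_const_mul, integral_comp_mul_left_Ioi (fun u => u ^ n * b u) 0 (inv_pos.2 hy),
      mul_zero, hb.moment, smul_eq_mul, inv_inv]
    field_simp

lemma integrable_mulConv_prod (hw : IsUnitWeight w m) (hb : IsUnitWeight b m') (n : ℕ) :
    Integrable (Function.uncurry fun x y : ℝ => x ^ n * (w y * (b (x / y) / y)))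
      ((volume.restrict (Ioi 0)).prod (volume.restrict (Ioi 0))) := by
  refine (integrable_prod_iff' ?_).2 ⟨?_, ?_⟩
  · rw [Measure.prod_restrict]
    refine ContinuousOn.aestronglyMeasurable ?_ (measurableSet_Ioi.prod measurableSet_Ioi)
    refine (continuousOn_fst.pow n).mul (ContinuousOn.mul ?_ (continuousOn_div_const_comp hb))
    exact hw.continuousOn.comp continuousOn_snd fun z hz => hz.2
  · exact ae_restrict_of_forall_mem measurableSet_Ioi fun y hy =>
      (integral_mulConv_inner hb n hy).1
  · refine IntegrableOn.congr_fun ((hw.integrableOn n).mul_const (m' n)) (fun y (hy : 0 < y) => ?_)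
      measurableSet_Ioi
    rw [← (integral_mulConv_inner hb n hy).2]
    refine setIntegral_congr_fun measurableSet_Ioi fun x (hx : 0 < x) => ?_
    have : 0 ≤ x ^ n * (w y * (b (x / y) / y)) :=
      mul_nonneg (pow_nonneg hx.le n)
        (mul_nonneg (hw.nonneg hy) (div_nonneg (hb.nonneg (div_pos hx hy)) hy.le))
    exact (Real.norm_of_nonneg this).symm

lemma IsUnitWeight.mulConv (hw : IsUnitWeight w m) (hb : IsUnitWeight b m') :
    IsUnitWeight (mulConv w b) fun n => m n * m' n where
  continuousOn := continuousOn_mulConv hw hb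
  eq_zero := mulConv_eq_zero hw hb
  pos := mulConv_pos hw hb
  integrableOn n := by
    have h := (integrable_mulConv_prod hw hb n).integral_prod_left
    simp only [Function.uncurry_apply_pair, integral_const_mul] at h
    exact h
  moment n := by
    have h := integral_integral_swap (integrable_mulConv_prod hw hb n)
    simp only [integral_const_mul] at h
    refine h.trans ?_
    rw [setIntegral_congr_fun measurableSet_Ioi fun y hy => (integral_mulConv_inner hb n hy).2,
      integral_mul_const, hw.moment]

/-- The density `x ^ (a - 1) * (1 - x) ^ (c - 1) / Γ(c)` on `(0, 1)`, extended by zero. -/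
noncomputable def betaDensity (a c x : ℝ) : ℝ :=
  x ^ (a - 1) * max (1 - x) 0 ^ (c - 1) / Real.Gamma c

lemma betaDensity_eq_zero {a c x : ℝ} (hc : 1 < c) (hx : 1 ≤ x) : betaDensity a c x = 0 := by
  rw [betaDensity, max_eq_right (by linarith), Real.zero_rpow (by linarith), mul_zero, zero_div]

lemma isUnitWeight_betaDensity {a c : ℝ} (ha : 0 < a) (hc : 1 < c) :
    IsUnitWeight (betaDensity a c)
      fun n => Real.Gamma (n + a) / Real.Gamma (n + a + c) := by
  have hc0 : 0 < c := by linarith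
  have e (n : ℕ) {x : ℝ} (hx : x ∈ Ioc (0 : ℝ) 1) : x ^ n * betaDensity a c x =
      x ^ (n + a - 1) * (1 - x) ^ (c - 1) / Real.Gamma c := by
    rw [betaDensity, max_eq_left (by linarith [hx.2]), add_sub_assoc, add_comm (n : ℝ),
      Real.rpow_add_natCast hx.1.ne']
    ring
  have hna (n : ℕ) : 0 < n + a := by positivity
  have hsub : Ioc (0 : ℝ) 1 ⊆ Ioi 0 := Ioc_subset_Ioi_self
  have hout (n : ℕ) : ∀ x ∈ Ioi (0 : ℝ) \ Ioc 0 1, x ^ n * betaDensity a c x = 0 := fun x hx => by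
    have : 1 < x := by
      by_contra! h
      exact hx.2 ⟨hx.1, h⟩
    rw [betaDensity_eq_zero hc this.le, mul_zero]
  constructor
  · intro x (hx : 0 < x)
    refine ContinuousAt.continuousWithinAt ?_
    refine ContinuousAt.div_const (ContinuousAt.mul ?_ ?_) _
    · exact Real.continuousAt_rpow_const _ _ (Or.inl hx.ne')
    · refine ContinuousAt.rpow_const (by fun_prop) (Or.inr (by linarith))
  · exact fun hx => betaDensity_eq_zero hc hx
  · intro x h0 h1
    have h2 : 0 < 1 - x := by linarith
    have := Real.Gamma_pos_of_pos hc0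
    rw [betaDensity, max_eq_left h2.le]
    positivity
  · intro n
    refine IntegrableOn.of_forall_sdiff_eq_zero (s := Ioc 0 1) ?_ measurableSet_Ioi (hout n)
    exact IntegrableOn.congr_fun (Integrable.div_const (integrableOn_beta (hna n) hc0) _)
      (fun x hx => (e n hx).symm) measurableSet_Ioc
  · intro n
    rw [setIntegral_eq_of_subset_of_forall_sdiff_eq_zero measurableSet_Ioi hsub (hout n),
      setIntegral_congr_fun measurableSet_Ioc fun x hx => e n hx, integral_div,
      setIntegral_beta (hna n) hc0]
    have := (Real.Gamma_pos_of_pos hc0).ne'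
    field_simp

lemma exists_isUnitWeight_gammaRatio {a c : ℕ → ℝ} {S : Finset ℕ} (hS : S.Nonempty)
    (ha : ∀ l ∈ S, 0 < a l) (hc : ∀ l ∈ S, 1 < c l) :
    ∃ w, IsUnitWeight w fun n => gammaRatio a c S n := by
  induction hS using Finset.Nonempty.cons_induction with
  | singleton l =>
    refine ⟨_, (isUnitWeight_betaDensity (ha l (Finset.mem_singleton_self l))
      (hc l (Finset.mem_singleton_self l))).congr_moment fun n => ?_⟩
    simp [gammaRatio]
  | cons l S hl hS ih =>
    obtain ⟨w, hw⟩ := ih (fun k hk => ha k (Finset.mem_cons_of_mem hk))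
      fun k hk => hc k (Finset.mem_cons_of_mem hk)
    refine ⟨_, ((isUnitWeight_betaDensity (ha l (Finset.mem_cons_self l S))
      (hc l (Finset.mem_cons_self l S))).mulConv hw).congr_moment fun n => ?_⟩
    rw [Finset.cons_eq_insert, gammaRatio_insert _ _ hl]

end UnitWeight

/-! ### Gauss's multiplication formula -/

/-- Take norms in `∏ (1 - ζ^k) = n + 1` for a primitive root of unity `ζ` of order `n + 1`, using
`|1 - e^{iθ}| = 2 |sin(θ/2)|`. -/
lemma prod_two_mul_sin (n : ℕ) :
    ∏ k ∈ Finset.range n, (2 * Real.sin (Real.pi * (((k : ℝ) + 1) / ((n + 1 : ℕ) : ℝ)))) =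
      (n + 1 : ℕ) := by
  have h := (Complex.isPrimitiveRoot_exp (n + 1) n.succ_ne_zero).prod_one_sub_pow_eq_order
  have h2 := congrArg norm h
  rw [norm_prod, ← Nat.cast_add_one, Complex.norm_natCast] at h2
  refine (Finset.prod_congr rfl fun k hk => ?_).trans h2
  have hn : (0 : ℝ) < (n + 1 : ℕ) := by positivity
  have e : Complex.exp (2 * Real.pi * Complex.I / ((n + 1 : ℕ) : ℂ)) ^ (k + 1) =
      Complex.exp (Complex.I * (2 * Real.pi * (((k : ℝ) + 1) / ((n + 1 : ℕ) : ℝ)) : ℝ)) := by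
    rw [← Complex.exp_nat_mul]
    congr 1
    push_cast
    ring
  rw [e, norm_sub_rev, Complex.norm_exp_I_mul_ofReal_sub_one, mul_assoc (2 : ℝ),
    mul_div_cancel_left₀ _ two_ne_zero, Real.norm_of_nonneg]
  refine mul_nonneg zero_le_two (Real.sin_nonneg_of_nonneg_of_le_pi (by positivity) ?_)
  refine mul_le_of_le_one_right Real.pi_pos.le ((div_le_one hn).2 ?_)
  have := Finset.mem_range.1 hk
  exact_mod_cast (by omega : k + 1 ≤ n + 1)

/-- The value at `1/d` of Gauss's multiplication formula. -/
lemma prod_Gamma_div {d : ℕ} (hd : 1 ≤ d) :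
    ∏ k ∈ Finset.Ico 1 d, Real.Gamma ((k : ℝ) / d) =
      (2 * Real.pi) ^ (((d : ℝ) - 1) / 2) / (d : ℝ) ^ (1 / 2 : ℝ) := by
  obtain ⟨n, rfl⟩ := Nat.exists_eq_add_of_le' hd
  have hn : (0 : ℝ) < (n + 1 : ℕ) := by positivity
  rw [Finset.prod_Ico_eq_prod_range, Nat.add_sub_cancel]
  simp only [Nat.cast_add (1 : ℕ), Nat.cast_one, add_comm (1 : ℝ)]
  set P := ∏ k ∈ Finset.range n, Real.Gamma (((k : ℝ) + 1) / ((n + 1 : ℕ) : ℝ)) with hP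
  have hP0 : 0 < P := Finset.prod_pos fun k _ => Real.Gamma_pos_of_pos (by positivity)
  have hrefl : P = ∏ k ∈ Finset.range n,
      Real.Gamma (1 - ((k : ℝ) + 1) / ((n + 1 : ℕ) : ℝ)) := by
    rw [hP, ← Finset.prod_range_reflect]
    refine Finset.prod_congr rfl fun k hk => ?_
    have := Finset.mem_range.1 hk
    congr 1
    rw [eq_sub_iff_add_eq, ← add_div, div_eq_one_iff_eq hn.ne']
    exact_mod_cast (by omega : n - 1 - k + 1 + (k + 1) = n + 1)
  -- Pairing the product with its reflection turns each pair into `π / sin`, and the sines multiply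
  -- to a known value.
  have hsq : P * P * ((n + 1 : ℕ) : ℝ) = (2 * Real.pi) ^ n := by
    rw [← prod_two_mul_sin n]
    nth_rewrite 2 [hrefl]
    rw [hP, ← Finset.prod_mul_distrib, ← Finset.prod_mul_distrib]
    refine (Finset.prod_congr rfl fun k hk => ?_).trans
      (by rw [Finset.prod_const, Finset.card_range])
    have hs : 0 < Real.sin (Real.pi * (((k : ℝ) + 1) / ((n + 1 : ℕ) : ℝ))) := by
      refine Real.sin_pos_of_pos_of_lt_pi (by positivity) ?_
      refine mul_lt_of_lt_one_right Real.pi_pos ((div_lt_one hn).2 ?_)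
      have := Finset.mem_range.1 hk
      exact_mod_cast (by omega : k + 1 < n + 1)
    rw [Real.Gamma_mul_Gamma_one_sub, mul_comm 2, ← mul_assoc, div_mul_cancel₀ _ hs.ne', mul_comm]
  rw [Nat.cast_add_one, add_sub_cancel_right, ← Nat.cast_add_one]
  have hr : 0 < (2 * Real.pi) ^ ((n : ℝ) / 2) / ((n + 1 : ℕ) : ℝ) ^ (1 / 2 : ℝ) := by positivity
  refine (mul_self_inj hP0.le hr.le).1 ?_
  rw [div_mul_div_comm, ← Real.rpow_add (by positivity), ← Real.rpow_add hn, add_halves,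
    add_halves, Real.rpow_one, Real.rpow_natCast, eq_div_iff hn.ne', hsq]

/-- Passing from `n` to `n + 1` multiplies the left side by `(dn + 1) ⋯ (dn + d) = d^d ∏ (n + k/d)`,
and the gamma factors by the same linear terms. -/
lemma factorial_mul_eq_prod_Gamma {d : ℕ} (hd : 1 ≤ d) (n : ℕ) :
    ((d * n)! : ℝ) = ((d : ℝ) ^ d) ^ n *
      ∏ k ∈ Finset.Ico 1 (d + 1), Real.Gamma (n + (k : ℝ) / d) / Real.Gamma ((k : ℝ) / d) := by
  have hd0 : (0 : ℝ) < d := by exact_mod_cast hd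
  have hpos (k : ℕ) (hk : k ∈ Finset.Ico 1 (d + 1)) : 0 < (k : ℝ) / d := by
    have : (0 : ℝ) < k := by exact_mod_cast (Finset.mem_Ico.1 hk).1
    positivity
  induction n with
  | zero =>
    rw [Finset.prod_eq_one fun k hk => ?_]
    · simp
    · rw [Nat.cast_zero, zero_add, div_self (Real.Gamma_pos_of_pos (hpos k hk)).ne']
  | succ n ih =>
    rw [Nat.mul_succ, ← Nat.factorial_mul_ascFactorial, Nat.cast_mul, ih,
      Nat.ascFactorial_eq_prod_range, Nat.cast_prod, pow_succ, mul_assoc, mul_assoc]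
    congr 1
    have e : ∏ i ∈ Finset.range d, ((d * n + 1 + i : ℕ) : ℝ) =
        (d : ℝ) ^ d * ∏ k ∈ Finset.Ico 1 (d + 1), ((n : ℝ) + (k : ℝ) / d) := by
      rw [Finset.prod_Ico_eq_prod_range, Nat.add_sub_cancel]
      have hpow : (d : ℝ) ^ d = ∏ _i ∈ Finset.range d, (d : ℝ) := by simp
      rw [hpow, ← Finset.prod_mul_distrib]
      refine Finset.prod_congr rfl fun i _ => ?_
      push_cast
      field_simp
      ring
    rw [e, mul_left_comm, ← Finset.prod_mul_distrib]
    congr 1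
    refine Finset.prod_congr rfl fun k hk => ?_
    have := hpos k hk
    rw [Nat.cast_add_one, add_right_comm, Real.Gamma_add_one (by positivity)]
    ring

/-! ### Catalan numbers as scaled gamma ratios -/

/-- The shift `l/d`. With `catalanShift d` and `catalanGap d`, `gammaRatio` over `1 ≤ l < d` is
`∏_{l=1}^{d-1} Γ(s + l/d) / Γ(s + l + 1)`. -/
noncomputable def catalanShift (d l : ℕ) : ℝ := (l : ℝ) / d

/-- The gap `l + 1 - l/d` between the lower and the upper shift. -/
noncomputable def catalanGap (d l : ℕ) : ℝ := (l : ℝ) + 1 - (l : ℝ) / d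

/-- The `k = d` factor `Γ(n + 1)` of the multiplication formula cancels the `n!` coming from `p =
0`; the rest pairs `Γ(n + p/d)` with `(n + p)!`. -/
lemma catalanDim_eq {d : ℕ} (hd : 2 ≤ d) (n : ℕ) :
    catalanDim d n = (2 * Real.pi) ^ ((1 - (d : ℝ)) / 2) * (d : ℝ) ^ (1 / 2 : ℝ) *
      (∏ p ∈ Finset.Ico 1 d, (p ! : ℝ)) * ((d : ℝ) ^ d) ^ n *
        gammaRatio (catalanShift d) (catalanGap d) (Finset.Ico 1 d) n := by
  have hd0 : (0 : ℝ) < d := by exact_mod_cast (by omega : 0 < d)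
  have hG : (∏ k ∈ Finset.Ico 1 d, Real.Gamma ((k : ℝ) / d))⁻¹ =
      (2 * Real.pi) ^ ((1 - (d : ℝ)) / 2) * (d : ℝ) ^ (1 / 2 : ℝ) := by
    rw [prod_Gamma_div (by omega), inv_div, div_eq_mul_inv, ← Real.rpow_neg (by positivity),
      mul_comm]
    ring_nf
  have hr : gammaRatio (catalanShift d) (catalanGap d) (Finset.Ico 1 d) n =
      ∏ p ∈ Finset.Ico 1 d, Real.Gamma (n + (p : ℝ) / d) / ((n + p)! : ℝ) := by
    refine Finset.prod_congr rfl fun p _ => ?_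
    rw [← Real.Gamma_nat_eq_factorial, catalanShift, catalanGap]
    congr 2
    push_cast
    ring
  rw [catalanDim, factorial_mul_eq_prod_Gamma (by omega), hr, ← hG,
    Finset.prod_Ico_succ_top (by omega), div_self hd0.ne', Real.Gamma_one, div_one,
    Real.Gamma_nat_eq_factorial, Finset.range_eq_Ico, Finset.prod_eq_prod_Ico_succ_bot (by omega)]
  simp only [Finset.prod_div_distrib, zero_add, add_zero, Nat.factorial_zero, Nat.cast_one]
  have : (n ! : ℝ) ≠ 0 := by positivity
  field_simp

/-! ### Residues as hypergeometric terms -/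

lemma Gamma_sub_natCast_mul {z : ℝ} (hz : ∀ k : ℕ, z ≠ k + 1) (i : ℕ) :
    Real.Gamma (z - i) * (ascPochhammer ℝ i).eval (1 - z) = (-1) ^ i * Real.Gamma z := by
  induction i with
  | zero => simp
  | succ i ih =>
    have h : z - (i + 1 : ℕ) ≠ 0 := by
      rw [sub_ne_zero]
      exact_mod_cast hz i
    have e : z - i = z - (i + 1 : ℕ) + 1 := by push_cast; ring
    rw [e, Real.Gamma_add_one h] at ih
    rw [pow_succ, mul_assoc, mul_comm (-1), ← mul_assoc, ← ih, ascPochhammer_succ_eval]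
    push_cast
    ring

lemma Gamma_sub_natCast {z : ℝ} (hz : ∀ k : ℤ, z ≠ k) (i : ℕ) :
    Real.Gamma (z - i) = (-1) ^ i * Real.Gamma z / (ascPochhammer ℝ i).eval (1 - z) := by
  have h := Gamma_sub_natCast_mul (z := z) (fun k => by exact_mod_cast hz (k + 1)) i
  have h0 : Real.Gamma z ≠ 0 := Real.Gamma_ne_zero fun m => by exact_mod_cast hz (-m)
  refine (eq_div_iff fun h1 => ?_).2 h
  rw [h1, mul_zero] at h
  exact mul_ne_zero (pow_ne_zero i (by norm_num)) h0 h.symm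

lemma intCast_div_ne_intCast {d : ℕ} {k : ℤ} (h0 : k ≠ 0) (hk : |k| < d) (n : ℤ) :
    (k : ℝ) / d ≠ n := by
  have hd : (d : ℝ) ≠ 0 := by
    rintro h
    have : (0 : ℤ) < d := (abs_nonneg k).trans_lt hk
    have h' : d = 0 := by exact_mod_cast h
    omega
  intro h
  rw [div_eq_iff hd] at h
  have h1 : k = n * d := by exact_mod_cast h
  exact h0 (Int.eq_zero_of_abs_lt_dvd ⟨n, by rw [h1, mul_comm]⟩ hk)

/-- The indices above and below `d - j` give the differences `1, …, j - 1` and `-1, …, -(d - j -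
1)`. This is the origin of the two sequences of lower parameters. -/
lemma prod_Ico_erase_sub {d j : ℕ} (hj : j ∈ Finset.Ico 1 d) (f : ℝ → ℝ) :
    ∏ m ∈ (Finset.Ico 1 d).erase (d - j), f (((m : ℝ) - (d - j : ℕ)) / d) =
      (∏ i ∈ Finset.range (j - 1), f (((i : ℝ) + 1) / d)) *
        ∏ i ∈ Finset.range (d - j - 1), f (-(((i : ℝ) + 1) / d)) := by
  obtain ⟨hj1, hjd⟩ := Finset.mem_Ico.1 hj
  have hS : (Finset.Ico 1 d).erase (d - j) =
      Finset.Ico (d - j + 1) d ∪ Finset.Ico 1 (d - j) := by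
    ext m
    simp only [Finset.mem_erase, Finset.mem_Ico, Finset.mem_union]
    omega
  rw [hS, Finset.prod_union (Finset.disjoint_left.2 fun m => by simp only [Finset.mem_Ico]; omega)]
  congr 1
  · rw [Finset.prod_Ico_eq_prod_range, show d - (d - j + 1) = j - 1 by omega]
    refine Finset.prod_congr rfl fun i _ => congrArg f ?_
    push_cast
    ring
  · rw [Finset.prod_Ico_eq_prod_range, ← Finset.prod_range_reflect]
    refine Finset.prod_congr rfl fun i hi => congrArg f ?_
    have h1 := Finset.mem_range.1 hi
    have h2 : (((1 + (d - j - 1 - 1 - i) : ℕ) : ℝ)) = (d - j : ℕ) - ((i : ℝ) + 1) := by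
      rw [eq_sub_iff_add_eq]
      exact_mod_cast (by omega : 1 + (d - j - 1 - 1 - i) + (i + 1) = d - j)
    rw [h2]
    ring

/-- Removes a monadic cast of the index multiset from `ℕ` to `ℝ`, leaving a single `map` with a
natural index. -/
lemma upperParams_eq (d j : ℕ) :
    upperParams d j = (Multiset.range (d - 1)).map fun i : ℕ => -(i : ℝ) - (j : ℝ) / (d : ℝ) := by
  simp only [upperParams, Multiset.bind_def, Multiset.pure_def, Multiset.bind_singleton,
    Multiset.map_map, Function.comp_def]

lemma lowerParams_eq (d j : ℕ) :
    lowerParams d j = ((Multiset.range (j - 1)).map fun i : ℕ => 1 - ((i : ℝ) + 1) / (d : ℝ)) +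
      ((Multiset.range (d - j - 1)).map fun i : ℕ => 1 + ((i : ℝ) + 1) / (d : ℝ)) := by
  simp only [lowerParams, Multiset.bind_def, Multiset.pure_def, Multiset.bind_singleton,
    Multiset.map_map, Function.comp_def]

lemma prod_map_upperParams (d j : ℕ) (f : ℝ → ℝ) :
    ((upperParams d j).map f).prod = ∏ m ∈ Finset.Ico 1 d, f (1 - ((m : ℝ) + (j : ℝ) / d)) := by
  rw [upperParams_eq, Multiset.map_map, Finset.prod_Ico_eq_prod_range]
  change ∏ i ∈ Finset.range (d - 1), f (-(i : ℝ) - (j : ℝ) / d) = _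
  refine Finset.prod_congr rfl fun i _ => congrArg f ?_
  push_cast
  ring

lemma prod_map_lowerParams {d j : ℕ} (hj : j ∈ Finset.Ico 1 d) (f : ℝ → ℝ) :
    ((lowerParams d j).map f).prod =
      ∏ m ∈ (Finset.Ico 1 d).erase (d - j), f (1 - ((m : ℝ) - (d - j : ℕ)) / d) := by
  rw [prod_Ico_erase_sub hj fun x => f (1 - x)]
  simp only [sub_neg_eq_add]
  rw [lowerParams_eq, Multiset.map_add, Multiset.prod_add, Multiset.map_map, Multiset.map_map]
  rfl

lemma weightCoeff_eq {d j : ℕ} (hj : j ∈ Finset.Ico 1 d) :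
    weightCoeff d j = (2 * Real.pi) ^ ((1 - (d : ℝ)) / 2) * (d : ℝ) ^ ((j : ℝ) - (d : ℝ) + 1 / 2) *
      (∏ p ∈ Finset.Ico 1 d, (p ! : ℝ)) *
      ((∏ m ∈ Finset.Ico 1 d, Real.Gamma ((m : ℝ) + (j : ℝ) / d))⁻¹ *
        ∏ m ∈ (Finset.Ico 1 d).erase (d - j), Real.Gamma (((m : ℝ) - (d - j : ℕ)) / d)) := by
  have h1 : ∏ k ∈ Finset.Ico 1 j, Real.Gamma ((k : ℝ) / (d : ℝ)) =
      ∏ i ∈ Finset.range (j - 1), Real.Gamma (((i : ℝ) + 1) / d) := by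
    rw [Finset.prod_Ico_eq_prod_range]
    simp only [Nat.cast_add, Nat.cast_one, add_comm]
  have h2 : ∏ k ∈ Finset.Ico (j + 1) d, Real.Gamma (((j : ℝ) - (k : ℝ)) / (d : ℝ)) =
      ∏ i ∈ Finset.range (d - j - 1), Real.Gamma (-(((i : ℝ) + 1) / d)) := by
    rw [Finset.prod_Ico_eq_prod_range, Nat.sub_sub]
    refine Finset.prod_congr rfl fun i _ => congrArg Real.Gamma ?_
    push_cast
    ring
  rw [prod_Ico_erase_sub hj, weightCoeff, h1, h2, Finset.prod_div_distrib]
  ring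

lemma natCast_sub_div {d j : ℕ} (hj : j ∈ Finset.Ico 1 d) :
    (((d - j : ℕ) : ℝ)) / d = 1 - (j : ℝ) / d := by
  obtain ⟨hj1, hjd⟩ := Finset.mem_Ico.1 hj
  have hd : (d : ℝ) ≠ 0 := by exact_mod_cast (by omega : d ≠ 0)
  rw [Nat.cast_sub hjd.le, sub_div, div_self hd]

/-- At the pole `-(1 - j/d) - i` the gamma arguments are `(m - (d - j))/d - i` above and `m + j/d -
i` below. Neither is an integer, so lowering by `i` produces Pochhammer symbols, and the signs
`(-1)^i` cancel in each quotient. The omitted index `m = d - j` is supplied by `betaCoeff`, with gap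
`d - j + j/d`. -/
lemma gammaRes_catalan_eq {d j : ℕ} (hj : j ∈ Finset.Ico 1 d) (i : ℕ) :
    gammaRes (catalanShift d) (catalanGap d) (Finset.Ico 1 d) (d - j) i =
      (∏ m ∈ Finset.Ico 1 d, (ascPochhammer ℝ i).eval (1 - ((m : ℝ) + (j : ℝ) / d)) /
        Real.Gamma ((m : ℝ) + (j : ℝ) / d)) / (i ! : ℝ) *
      ∏ m ∈ (Finset.Ico 1 d).erase (d - j), Real.Gamma (((m : ℝ) - (d - j : ℕ)) / d) /
        (ascPochhammer ℝ i).eval (1 - ((m : ℝ) - (d - j : ℕ)) / d) := by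
  obtain ⟨hj1, hjd⟩ := Finset.mem_Ico.1 hj
  have hl : d - j ∈ Finset.Ico 1 d := Finset.mem_Ico.2 (by omega)
  have hdj := natCast_sub_div hj
  have hg : catalanGap d (d - j) = ((d - j : ℕ) : ℝ) + (j : ℝ) / d := by
    rw [catalanGap, hdj]
    ring
  rw [gammaRes, gammaRatio, betaCoeff, hg, ← Finset.mul_prod_erase _ _ hl]
  have key : ∀ m ∈ (Finset.Ico 1 d).erase (d - j),
      Real.Gamma (-(catalanShift d (d - j) + i) + catalanShift d m) /
        Real.Gamma (-(catalanShift d (d - j) + i) + catalanShift d m + catalanGap d m) =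
      (ascPochhammer ℝ i).eval (1 - ((m : ℝ) + (j : ℝ) / d)) / Real.Gamma ((m : ℝ) + (j : ℝ) / d) *
        (Real.Gamma (((m : ℝ) - (d - j : ℕ)) / d) /
          (ascPochhammer ℝ i).eval (1 - ((m : ℝ) - (d - j : ℕ)) / d)) := by
    intro m hm
    obtain ⟨hmne, hm⟩ := Finset.mem_erase.1 hm
    obtain ⟨hm1, hmd⟩ := Finset.mem_Ico.1 hm
    have e1 : -(catalanShift d (d - j) + i) + catalanShift d m =
        ((m : ℝ) - (d - j : ℕ)) / d - i := by
      rw [catalanShift, catalanShift]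
      ring
    have e2 : -(catalanShift d (d - j) + i) + catalanShift d m + catalanGap d m =
        ((m : ℝ) + (j : ℝ) / d) - i := by
      rw [catalanShift, catalanShift, catalanGap, hdj]
      ring
    have z1 (n : ℤ) : ((m : ℝ) - (d - j : ℕ)) / d ≠ n := by
      have := intCast_div_ne_intCast (d := d) (k := (m : ℤ) - (d - j : ℕ)) (by omega)
        (by rw [abs_lt]; omega) n
      exact_mod_cast this
    have z2 (n : ℤ) : (m : ℝ) + (j : ℝ) / d ≠ n := by
      have := intCast_div_ne_intCast (d := d) (k := (j : ℤ)) (by omega)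
        (by rw [abs_lt]; omega) (n - m)
      intro h
      apply this
      push_cast
      linarith
    rw [e2, e1, Gamma_sub_natCast z1, Gamma_sub_natCast z2]
    have : ((-1 : ℝ)) ^ i ≠ 0 := pow_ne_zero i (by norm_num)
    rw [div_div_div_eq, mul_assoc, mul_left_comm _ ((-1 : ℝ) ^ i), mul_div_mul_left _ _ this]
    ring
  rw [Finset.prod_congr rfl key, Finset.prod_mul_distrib]
  ring

lemma weightCoeff_mul_hypTerm {d j : ℕ} (hj : j ∈ Finset.Ico 1 d) (z : ℝ) (i : ℕ) :
    weightCoeff d j * hypTerm (upperParams d j) (lowerParams d j) z i =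
      (2 * Real.pi) ^ ((1 - (d : ℝ)) / 2) * (d : ℝ) ^ ((j : ℝ) - (d : ℝ) + 1 / 2) *
        (∏ p ∈ Finset.Ico 1 d, (p ! : ℝ)) *
        (gammaRes (catalanShift d) (catalanGap d) (Finset.Ico 1 d) (d - j) i * z ^ i) := by
  rw [hypTerm, prod_map_upperParams, prod_map_lowerParams hj, weightCoeff_eq hj,
    gammaRes_catalan_eq hj, Finset.prod_div_distrib, Finset.prod_div_distrib]
  ring

lemma weightCoeff_ne_zero {d j : ℕ} (hj : j ∈ Finset.Ico 1 d) : weightCoeff d j ≠ 0 := by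
  obtain ⟨hj1, hjd⟩ := Finset.mem_Ico.1 hj
  have hd : (0 : ℝ) < d := by exact_mod_cast (by omega : 0 < d)
  rw [weightCoeff_eq hj]
  have h1 : ∏ p ∈ Finset.Ico 1 d, (p ! : ℝ) ≠ 0 :=
    Finset.prod_ne_zero_iff.2 fun p _ => by positivity
  have h2 : ∏ m ∈ Finset.Ico 1 d, Real.Gamma ((m : ℝ) + (j : ℝ) / d) ≠ 0 :=
    Finset.prod_ne_zero_iff.2 fun m hm => by
      have : (0 : ℝ) < m := by exact_mod_cast (Finset.mem_Ico.1 hm).1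
      exact (Real.Gamma_pos_of_pos (by positivity)).ne'
  have h3 : ∏ m ∈ (Finset.Ico 1 d).erase (d - j), Real.Gamma (((m : ℝ) - (d - j : ℕ)) / d) ≠ 0 :=
    Finset.prod_ne_zero_iff.2 fun m hm => by
      obtain ⟨hmne, hm⟩ := Finset.mem_erase.1 hm
      obtain ⟨hm1, hmd⟩ := Finset.mem_Ico.1 hm
      refine Real.Gamma_ne_zero fun n => ?_
      have := intCast_div_ne_intCast (d := d) (k := (m : ℤ) - (d - j : ℕ)) (by omega)
        (by rw [abs_lt]; omega) (-n)
      exact_mod_cast this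
  have h4 : (2 * Real.pi) ^ ((1 - (d : ℝ)) / 2) * (d : ℝ) ^ ((j : ℝ) - (d : ℝ) + 1 / 2) ≠ 0 := by
    positivity
  exact mul_ne_zero (mul_ne_zero h4 h1) (mul_ne_zero (inv_ne_zero h2) h3)

/-! ### The weight on the unit interval as a sum of power series -/

lemma one_lt_catalanGap {d l : ℕ} (hl : l ∈ Finset.Ico 1 d) : 1 < catalanGap d l := by
  obtain ⟨h1, h2⟩ := Finset.mem_Ico.1 hl
  have hl0 : (1 : ℝ) ≤ l := by exact_mod_cast h1
  have hd : (l : ℝ) < d := by exact_mod_cast h2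
  have : (l : ℝ) / d < 1 := (div_lt_one (by linarith)).2 hd
  rw [catalanGap]
  linarith

lemma catalanShift_pos {d l : ℕ} (hl : l ∈ Finset.Ico 1 d) : 0 < catalanShift d l := by
  obtain ⟨h1, h2⟩ := Finset.mem_Ico.1 hl
  have hl0 : (0 : ℝ) < l := by exact_mod_cast h1
  have hd : (0 : ℝ) < d := by exact_mod_cast h1.trans h2.le
  exact div_pos hl0 hd

lemma catalanShift_sub_ne_intCast {d l m : ℕ} (hl : l ∈ Finset.Ico 1 d) (hm : m ∈ Finset.Ico 1 d)
    (hlm : l ≠ m) (n : ℤ) : catalanShift d l - catalanShift d m ≠ n := by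
  rw [Finset.mem_Ico] at hl hm
  have := intCast_div_ne_intCast (d := d) (k := (l : ℤ) - m) (by omega) (by rw [abs_lt]; omega) n
  rw [catalanShift, catalanShift, ← sub_div]
  exact_mod_cast this

lemma nonempty_Ico_one {d : ℕ} (hd : 2 ≤ d) : (Finset.Ico 1 d).Nonempty :=
  ⟨1, Finset.mem_Ico.2 (by omega)⟩

lemma catalan_partialFractions {d : ℕ} (hd : 2 ≤ d) :
    (∀ l ∈ Finset.Ico 1 d,
        Summable (gammaRes (catalanShift d) (catalanGap d) (Finset.Ico 1 d) l)) ∧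
      ∀ n : ℕ, gammaRatio (catalanShift d) (catalanGap d) (Finset.Ico 1 d) n =
        ∑ l ∈ Finset.Ico 1 d, ∑' i : ℕ,
          gammaRes (catalanShift d) (catalanGap d) (Finset.Ico 1 d) l i /
            (n + catalanShift d l + i) := by
  obtain ⟨h1, h2⟩ := gammaRatio_partialFractions (catalanShift d) (catalanGap d)
    (nonempty_Ico_one hd) (fun l hl => one_lt_catalanGap hl)
    (fun l hl m hm hlm => catalanShift_sub_ne_intCast hl hm hlm)
  refine ⟨h1, fun n => ?_⟩
  rw [h2]
  · simp only [add_assoc]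
  · intro l hl i
    have := catalanShift_pos hl
    positivity

/-- The function on `(0, 1]` with moments `gammaRatio (catalanShift d) (catalanGap d)`, as a sum of
power series. -/
noncomputable def catalanSeries (d : ℕ) (t : ℝ) : ℝ :=
  ∑ l ∈ Finset.Ico 1 d, t ^ (catalanShift d l - 1) *
    ∑' i : ℕ, gammaRes (catalanShift d) (catalanGap d) (Finset.Ico 1 d) l i * t ^ i

lemma continuousOn_catalanSeries {d : ℕ} (hd : 2 ≤ d) :
    ContinuousOn (catalanSeries d) (Set.Ioc 0 1) := by
  refine continuousOn_finsetSum _ fun l hl => ContinuousOn.mul ?_ ?_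
  · exact fun x hx => (Real.continuousAt_rpow_const _ _ (Or.inl hx.1.ne')).continuousWithinAt
  · exact (continuousOn_tsum_mul_pow ((catalan_partialFractions hd).1 l hl)).mono
      Set.Ioc_subset_Icc_self

lemma pow_mul_catalanSeries (d n : ℕ) {t : ℝ} (ht : 0 < t) : t ^ n * catalanSeries d t =
    ∑ l ∈ Finset.Ico 1 d, t ^ ((n : ℝ) + catalanShift d l - 1) *
      ∑' i : ℕ, gammaRes (catalanShift d) (catalanGap d) (Finset.Ico 1 d) l i * t ^ i := by
  rw [catalanSeries, Finset.mul_sum]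
  refine Finset.sum_congr rfl fun l _ => ?_
  rw [add_sub_assoc, add_comm (n : ℝ), Real.rpow_add_natCast ht.ne']
  ring

open MeasureTheory in
lemma integrableOn_pow_mul_catalanSeries {d : ℕ} (hd : 2 ≤ d) (n : ℕ) :
    IntegrableOn (fun t => t ^ n * catalanSeries d t) (Set.Ioc 0 1) := by
  refine IntegrableOn.congr_fun ?_ (fun t ht => (pow_mul_catalanSeries d n ht.1).symm)
    measurableSet_Ioc
  refine integrable_finsetSum _ fun l hl => ?_
  have := catalanShift_pos hl
  exact integrableOn_rpow_mul_tsum ((catalan_partialFractions hd).1 l hl) (by positivity)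

open MeasureTheory in
lemma integral_pow_mul_catalanSeries {d : ℕ} (hd : 2 ≤ d) (n : ℕ) :
    ∫ t in Set.Ioc (0 : ℝ) 1, t ^ n * catalanSeries d t =
      gammaRatio (catalanShift d) (catalanGap d) (Finset.Ico 1 d) n := by
  have hp (l : ℕ) (hl : l ∈ Finset.Ico 1 d) : 0 < (n : ℝ) + catalanShift d l := by
    have := catalanShift_pos hl
    positivity
  have hs := (catalan_partialFractions hd).1
  rw [setIntegral_congr_fun measurableSet_Ioc fun t ht => pow_mul_catalanSeries d n ht.1,
    integral_finsetSum _ fun l hl => integrableOn_rpow_mul_tsum (hs l hl) (hp l hl),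
    (catalan_partialFractions hd).2 n]
  exact Finset.sum_congr rfl fun l hl => setIntegral_rpow_mul_tsum (hs l hl) (hp l hl)

open MeasureTheory in
lemma IsUnitWeight.eqOn_catalanSeries {d : ℕ} (hd : 2 ≤ d) {w : ℝ → ℝ}
    (hw : IsUnitWeight w fun n => gammaRatio (catalanShift d) (catalanGap d) (Finset.Ico 1 d) n) :
    Set.EqOn w (catalanSeries d) (Set.Ioc 0 1) := by
  refine eqOn_Ioc_of_moments_eq (hw.continuousOn.mono Set.Ioc_subset_Ioi_self)
    (continuousOn_catalanSeries hd)
    (fun n => (hw.integrableOn n).mono_set Set.Ioc_subset_Ioi_self)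
    (integrableOn_pow_mul_catalanSeries hd) fun n => ?_
  rw [integral_pow_mul_catalanSeries hd, ← hw.moment n]
  refine (setIntegral_eq_of_subset_of_forall_sdiff_eq_zero measurableSet_Ioi
    Set.Ioc_subset_Ioi_self fun x hx => ?_).symm
  rw [hw.eq_zero, mul_zero]
  by_contra! h
  exact hx.2 ⟨hx.1, h.le⟩

/-! ### Rescaling to `(0, d^d]` -/

/-- The constant `K` with `C_d(n) = K * (d ^ d) ^ (n + 1) * ∏_{l=1}^{d-1} Γ(n + l/d) / Γ(n + l + 1)`. -/
noncomputable def catalanConst (d : ℕ) : ℝ :=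
  (2 * Real.pi) ^ ((1 - (d : ℝ)) / 2) * (d : ℝ) ^ (1 / 2 : ℝ) *
    (∏ p ∈ Finset.Ico 1 d, (p ! : ℝ)) / (d : ℝ) ^ d

lemma catalanConst_pos {d : ℕ} (hd : 2 ≤ d) : 0 < catalanConst d := by
  have hd0 : (0 : ℝ) < d := by exact_mod_cast (by omega : 0 < d)
  have : 0 < ∏ p ∈ Finset.Ico 1 d, (p ! : ℝ) := Finset.prod_pos fun p _ => by positivity
  rw [catalanConst]
  positivity

open MeasureTheory in
lemma IsUnitWeight.isCatalanWeight {d : ℕ} (hd : 2 ≤ d) {w : ℝ → ℝ}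
    (hw : IsUnitWeight w fun n => gammaRatio (catalanShift d) (catalanGap d) (Finset.Ico 1 d) n) :
    IsCatalanWeight d ((d : ℝ) ^ d) (fun x => catalanConst d * w (x / (d : ℝ) ^ d)) ∧
      ∀ x ∈ Set.Ioo (0 : ℝ) ((d : ℝ) ^ d), 0 < catalanConst d * w (x / (d : ℝ) ^ d) := by
  have hd0 : (0 : ℝ) < d := by exact_mod_cast (by omega : 0 < d)
  have hK := catalanConst_pos hd
  have hc := catalanDim_eq hd
  have hKD : catalanConst d * (d : ℝ) ^ d = (2 * Real.pi) ^ ((1 - (d : ℝ)) / 2) *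
      (d : ℝ) ^ (1 / 2 : ℝ) * (∏ p ∈ Finset.Ico 1 d, (p ! : ℝ)) :=
    div_mul_cancel₀ _ (by positivity)
  rw [← hKD] at hc
  have hD : (0 : ℝ) < (d : ℝ) ^ d := by positivity
  set D : ℝ := (d : ℝ) ^ d
  have hpos : ∀ x ∈ Set.Ioo (0 : ℝ) D, 0 < catalanConst d * w (x / D) := fun x hx =>
    mul_pos hK (hw.pos (div_pos hx.1 hD) ((div_lt_one hD).2 hx.2))
  have e (n : ℕ) (x : ℝ) : x ^ n * (catalanConst d * w (x / D)) =
      catalanConst d * D ^ n * ((fun u => u ^ n * w u) (D⁻¹ * x)) := by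
    have : x ^ n = D ^ n * (D⁻¹ * x) ^ n := by rw [← mul_pow, mul_inv_cancel_left₀ hD.ne']
    rw [this, div_eq_inv_mul]
    ring
  refine ⟨⟨?_, ⟨fun x hx => hx.1.2, fun b hb => ?_⟩, fun n => ?_, fun n => ?_⟩, hpos⟩
  · refine continuousOn_const.mul (hw.continuousOn.comp (by fun_prop) fun x hx => ?_)
    exact Set.mem_Ioi.2 (div_pos hx.1 hD)
  -- Every point of `(0, D)` lies in the support; for `y ≤ 0` the midpoint `D / 2` is used instead.
  · refine le_of_forall_lt_imp_le_of_dense fun y hy => ?_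
    rcases le_or_gt y 0 with h0 | h0
    · refine h0.trans ((half_pos hD).le.trans (hb ⟨⟨half_pos hD, half_le_self hD.le⟩, ?_⟩))
      exact (hpos _ ⟨half_pos hD, half_lt_self hD⟩).ne'
    · exact hb ⟨⟨h0, hy.le⟩, (hpos y ⟨h0, hy⟩).ne'⟩
  · refine IntegrableOn.mono_set ?_ (Set.Ioc_subset_Ioi_self (a := D) (b := 0))
    simp only [e]
    refine Integrable.const_mul ?_ _
    refine (integrableOn_Ioi_comp_mul_left_iff (fun u => u ^ n * w u) 0 (inv_pos.2 hD)).2 ?_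
    rw [mul_zero]
    exact hw.integrableOn n
  · have h1 : ∫ x in Set.Ioi (0 : ℝ), x ^ n * (catalanConst d * w (x / D)) = catalanDim d n := by
      simp only [e]
      rw [integral_const_mul,
        integral_comp_mul_left_Ioi (fun u => u ^ n * w u) 0 (inv_pos.2 hD), mul_zero, hw.moment,
        smul_eq_mul, inv_inv, hc]
      ring
    rw [← h1]
    refine (setIntegral_eq_of_subset_of_forall_sdiff_eq_zero measurableSet_Ioi
      Set.Ioc_subset_Ioi_self fun x hx => ?_).symm
    rw [hw.eq_zero, mul_zero, mul_zero]
    rw [one_le_div hD]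
    by_contra! h
    exact hx.2 ⟨hx.1, h.le⟩

/-- Up to nonzero constants the terms are the absolutely summable residues times `t^i`, so `t = 1`
is included. -/
lemma summable_hypTerm {d j : ℕ} (hd : 2 ≤ d) (hj : j ∈ Finset.Ico 1 d) {t : ℝ} (h0 : 0 ≤ t)
    (h1 : t ≤ 1) : Summable (hypTerm (upperParams d j) (lowerParams d j) t) := by
  have hl : d - j ∈ Finset.Ico 1 d := by rw [Finset.mem_Ico] at *; omega
  rw [← summable_mul_left_iff (weightCoeff_ne_zero hj)]
  simp only [weightCoeff_mul_hypTerm hj]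
  exact (summable_mul_pow ((catalan_partialFractions hd).1 _ hl) h0 h1).mul_left _

/-- Reindex by `l = d - j`: then `t^(l/d - 1) = t^(-j/d)`, and `(d^d)^(j/d) = d^j` accounts for the
power `d^(j - d + 1/2)` in the coefficient. -/
lemma catalanConst_mul_catalanSeries {d : ℕ} (hd : 2 ≤ d) {x : ℝ} (hx : 0 < x) :
    catalanConst d * catalanSeries d (x / (d : ℝ) ^ d) =
      ∑ j ∈ Finset.Ico 1 d, weightCoeff d j / x ^ ((j : ℝ) / (d : ℝ)) *
        hypPFQ (upperParams d j) (lowerParams d j) (x / (d : ℝ) ^ d) := by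
  have hd0 : (0 : ℝ) < d := by exact_mod_cast (by omega : 0 < d)
  have hD : (0 : ℝ) < (d : ℝ) ^ d := by positivity
  rw [catalanSeries, Finset.mul_sum]
  symm
  refine Finset.sum_nbij' (fun j => d - j) (fun l => d - l) ?_ ?_ ?_ ?_ ?_
  any_goals intro j hj; rw [Finset.mem_Ico] at *; omega
  intro j hj
  rw [div_mul_eq_mul_div, hypPFQ, ← tsum_mul_left]
  simp only [weightCoeff_mul_hypTerm hj]
  rw [tsum_mul_left]
  have e1 : catalanShift d (d - j) - 1 = -((j : ℝ) / d) := by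
    rw [catalanShift, natCast_sub_div hj]
    ring
  have e2 : ((d : ℝ) ^ d) ^ ((j : ℝ) / d) = (d : ℝ) ^ j := by
    rw [← Real.rpow_natCast, ← Real.rpow_mul hd0.le, mul_div_cancel₀ _ hd0.ne', Real.rpow_natCast]
  have e3 : (d : ℝ) ^ ((j : ℝ) - (d : ℝ) + 1 / 2) =
      (d : ℝ) ^ j / (d : ℝ) ^ d * (d : ℝ) ^ (1 / 2 : ℝ) := by
    rw [Real.rpow_add hd0, Real.rpow_sub hd0, Real.rpow_natCast, Real.rpow_natCast]
  rw [e1, Real.rpow_neg (by positivity), Real.div_rpow hx.le hD.le, e2, e3, catalanConst, inv_div]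
  ring

/-! ### Identification of the weight and the cases `d = 2, 3, 4, 5` -/

theorem IsCatalanWeight.eq {d : ℕ} (hd : 2 ≤ d) {R : ℝ} {W : ℝ → ℝ} (h : IsCatalanWeight d R W) :
    R = (d : ℝ) ^ d ∧ ∀ x ∈ Set.Ioc (0 : ℝ) ((d : ℝ) ^ d),
      W x = ∑ j ∈ Finset.Ico 1 d, weightCoeff d j / x ^ ((j : ℝ) / (d : ℝ)) *
        hypPFQ (upperParams d j) (lowerParams d j) (x / (d : ℝ) ^ d) := by
  obtain ⟨w, hw⟩ := exists_isUnitWeight_gammaRatio (nonempty_Ico_one hd)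
    (fun l hl => catalanShift_pos hl) (fun l hl => one_lt_catalanGap hl)
  obtain ⟨rfl, hE⟩ := h.unique (hw.isCatalanWeight hd).1
  refine ⟨rfl, fun x hx => ?_⟩
  have hd0 : (0 : ℝ) < d := by exact_mod_cast (by omega : 0 < d)
  have hD : (0 : ℝ) < (d : ℝ) ^ d := by positivity
  rw [hE hx, ← catalanConst_mul_catalanSeries hd hx.1]
  dsimp only
  rw [hw.eqOn_catalanSeries hd ⟨div_pos hx.1 hD, (div_le_one hD).2 hx.2⟩]

/-- For `d = 2` the product has one factor, so the weight is a rescaled beta density with `a = 1/2`,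
`c = 3/2`, and uniqueness gives the closed form without any series. -/
lemma IsCatalanWeight.eq_of_two {R : ℝ} {W : ℝ → ℝ} (h : IsCatalanWeight 2 R W) :
    ∀ x ∈ Set.Ioc (0 : ℝ) 4, W x = 1 / (2 * Real.pi) * Real.sqrt ((4 - x) / x) := by
  have hw : IsUnitWeight (betaDensity (1 / 2) (3 / 2))
      fun n => gammaRatio (catalanShift 2) (catalanGap 2) (Finset.Ico 1 2) n := by
    refine (isUnitWeight_betaDensity (by norm_num) (by norm_num)).congr_moment fun n => ?_
    norm_num [gammaRatio, catalanShift, catalanGap, add_assoc]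
  obtain ⟨rfl, hE⟩ := h.unique (hw.isCatalanWeight le_rfl).1
  intro x hx
  have h4 : 0 ≤ 1 - x / 4 := by linarith [hx.2]
  have hG : Real.Gamma (3 / 2) = Real.sqrt Real.pi / 2 := by
    rw [show (3 : ℝ) / 2 = 1 / 2 + 1 by norm_num, Real.Gamma_add_one (by norm_num),
      Real.Gamma_one_half_eq]
    ring
  have hK : catalanConst 2 = 1 / (4 * Real.sqrt Real.pi) := by
    have h2 : Real.sqrt 2 ≠ 0 := by positivity
    rw [catalanConst, Nat.cast_two, show (1 - (2 : ℝ)) / 2 = -(1 / 2) by norm_num,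
      Real.rpow_neg (by positivity), ← Real.sqrt_eq_rpow, ← Real.sqrt_eq_rpow,
      Real.sqrt_mul zero_le_two]
    norm_num
    field_simp
  have hx0 : 0 < x / 4 := by linarith [hx.1]
  have hD : ((2 : ℕ) : ℝ) ^ 2 = 4 := by norm_num
  rw [hD] at hE
  rw [hE hx]
  dsimp only
  rw [betaDensity, max_eq_left h4, hG, hK, show (1 / 2 : ℝ) - 1 = -(1 / 2) by norm_num,
    show (3 / 2 : ℝ) - 1 = 1 / 2 by norm_num, Real.rpow_neg hx0.le, ← Real.sqrt_eq_rpow,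
    ← Real.sqrt_eq_rpow, ← Real.sqrt_inv, ← Real.sqrt_mul (inv_nonneg.2 hx0.le)]
  have e : (x / 4)⁻¹ * (1 - x / 4) = (4 - x) / x := by
    have := hx.1.ne'
    field_simp
  have hp : Real.sqrt Real.pi * Real.sqrt Real.pi = Real.pi := Real.mul_self_sqrt Real.pi_pos.le
  have hp0 : Real.sqrt Real.pi ≠ 0 := (Real.sqrt_pos.2 Real.pi_pos).ne'
  rw [e]
  nth_rewrite 3 [← hp]
  field_simp
  ring

lemma Multiset.cons_cons_singleton_rotate {α : Type*} (a b c : α) :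
    a ::ₘ b ::ₘ {c} = b ::ₘ c ::ₘ ({a} : Multiset α) := by
  rw [Multiset.cons_swap]
  exact congrArg (b ::ₘ ·) (Multiset.pair_comm a c)

lemma Multiset.cons_cons_singleton_rev {α : Type*} (a b c : α) :
    a ::ₘ b ::ₘ {c} = c ::ₘ b ::ₘ ({a} : Multiset α) := by
  rw [Multiset.cons_cons_singleton_rotate, Multiset.cons_swap]

theorem mainTheorem2 :
    (∀ d : ℕ, 2 ≤ d →
      -- the hypergeometric series converge on the whole range, including the right end point
      (∀ j ∈ Finset.Ico 1 d, ∀ x ∈ Set.Ioc (0 : ℝ) ((d : ℝ) ^ d),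
        Summable (hypTerm (upperParams d j) (lowerParams d j) (x / (d : ℝ) ^ d))) ∧
      -- the weight exists and is positive
      (∃ W : ℝ → ℝ, IsCatalanWeight d ((d : ℝ) ^ d) W ∧
        ∀ x ∈ Set.Ioo (0 : ℝ) ((d : ℝ) ^ d), 0 < W x) ∧
      -- the upper edge of its support is `d ^ d` and it has the hypergeometric form
      (∀ (R : ℝ) (W : ℝ → ℝ), IsCatalanWeight d R W →
        R = (d : ℝ) ^ d ∧
        ∀ x ∈ Set.Ioc (0 : ℝ) ((d : ℝ) ^ d),
          W x = ∑ j ∈ Finset.Ico 1 d, weightCoeff d j / x ^ ((j : ℝ) / (d : ℝ)) *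
            hypPFQ (upperParams d j) (lowerParams d j) (x / (d : ℝ) ^ d))) ∧
    -- the special cases `d = 2, 3, 4, 5`
    (∀ (R : ℝ) (W : ℝ → ℝ), IsCatalanWeight 2 R W → ∀ x ∈ Set.Ioc (0 : ℝ) 4,
      W x = 1 / (2 * Real.pi) * Real.sqrt ((4 - x) / x)) ∧
    (∀ (R : ℝ) (W : ℝ → ℝ), IsCatalanWeight 3 R W → ∀ x ∈ Set.Ioc (0 : ℝ) (3 ^ 3),
      W x =
        weightCoeff 3 1 / x ^ (1 / 3 : ℝ) * hypPFQ {-4 / 3, -1 / 3} {4 / 3} (x / 3 ^ 3) +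
        weightCoeff 3 2 / x ^ (2 / 3 : ℝ) * hypPFQ {-5 / 3, -2 / 3} {2 / 3} (x / 3 ^ 3)) ∧
    (∀ (R : ℝ) (W : ℝ → ℝ), IsCatalanWeight 4 R W → ∀ x ∈ Set.Ioc (0 : ℝ) (4 ^ 4),
      W x =
        weightCoeff 4 1 / x ^ (1 / 4 : ℝ) *
          hypPFQ {-9 / 4, -5 / 4, -1 / 4} {5 / 4, 3 / 2} (x / 4 ^ 4) +
        weightCoeff 4 2 / x ^ (1 / 2 : ℝ) *
          hypPFQ {-5 / 2, -3 / 2, -1 / 2} {3 / 4, 5 / 4} (x / 4 ^ 4) +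
        weightCoeff 4 3 / x ^ (3 / 4 : ℝ) *
          hypPFQ {-11 / 4, -7 / 4, -3 / 4} {1 / 2, 3 / 4} (x / 4 ^ 4)) ∧
    (∀ (R : ℝ) (W : ℝ → ℝ), IsCatalanWeight 5 R W → ∀ x ∈ Set.Ioc (0 : ℝ) (5 ^ 5),
      W x =
        weightCoeff 5 1 / x ^ (1 / 5 : ℝ) *
          hypPFQ {-16 / 5, -11 / 5, -6 / 5, -1 / 5} {6 / 5, 7 / 5, 8 / 5} (x / 5 ^ 5) +
        weightCoeff 5 2 / x ^ (2 / 5 : ℝ) *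
          hypPFQ {-17 / 5, -12 / 5, -7 / 5, -2 / 5} {4 / 5, 6 / 5, 7 / 5} (x / 5 ^ 5) +
        weightCoeff 5 3 / x ^ (3 / 5 : ℝ) *
          hypPFQ {-18 / 5, -13 / 5, -8 / 5, -3 / 5} {3 / 5, 4 / 5, 6 / 5} (x / 5 ^ 5) +
        weightCoeff 5 4 / x ^ (4 / 5 : ℝ) *
          hypPFQ {-19 / 5, -14 / 5, -9 / 5, -4 / 5} {2 / 5, 3 / 5, 4 / 5} (x / 5 ^ 5)) := by
  refine ⟨fun d hd => ⟨fun j hj x hx => ?_, ?_, fun R W h => h.eq hd⟩,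
    fun R W h => h.eq_of_two, fun R W h x hx => ?_, fun R W h x hx => ?_, fun R W h x hx => ?_⟩
  · have hD : (0 : ℝ) < (d : ℝ) ^ d := hx.1.trans_le hx.2
    exact summable_hypTerm hd hj (div_nonneg hx.1.le hD.le) ((div_le_one hD).2 hx.2)
  · obtain ⟨w, hw⟩ := exists_isUnitWeight_gammaRatio (nonempty_Ico_one hd)
      (fun l hl => catalanShift_pos hl) (fun l hl => one_lt_catalanGap hl)
    exact ⟨_, hw.isCatalanWeight hd⟩
  · have h3 := (h.eq (by norm_num)).2 x (by exact_mod_cast hx)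
    rw [h3]
    simp only [Finset.sum_Ico_eq_sum_range, Finset.sum_range_succ, Finset.sum_range_zero,
      upperParams_eq, lowerParams_eq, Multiset.range_succ, Multiset.range_zero]
    norm_num
  · have h4 := (h.eq (by norm_num)).2 x (by exact_mod_cast hx)
    rw [h4]
    simp only [Finset.sum_Ico_eq_sum_range, Finset.sum_range_succ, Finset.sum_range_zero,
      upperParams_eq, lowerParams_eq, Multiset.range_succ, Multiset.range_zero]
    norm_num
    -- `Multiset.range_succ` lists indices in descending order, so only the order of the lower
    -- parameters for `j = 1` is left to fix.
    exact Or.inl (by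
      rw [show (3 / 2 : ℝ) ::ₘ {5 / 4} = 5 / 4 ::ₘ {3 / 2} from Multiset.pair_comm _ _])
  · have h5 := (h.eq (by norm_num)).2 x (by exact_mod_cast hx)
    rw [h5]
    simp only [Finset.sum_Ico_eq_sum_range, Finset.sum_range_succ, Finset.sum_range_zero,
      upperParams_eq, lowerParams_eq, Multiset.range_succ, Multiset.range_zero]
    norm_num
    rw [Multiset.cons_cons_singleton_rev (8 / 5), Multiset.cons_cons_singleton_rotate (7 / 5)]
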